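/- **Conventions.** Let $M$ be a closed oriented smooth 3-manifold and $L\subset M$ an oriented link (a closed oriented smooth 1-dimensional submanifold). A $k$-fold cyclic branched cover of $M$ along $L$ is a Hausdorff space $Y$ with a continuous surjection $q:Y\to M$ and a homeomorphism $t:Y\to Y$ with $t^k=\mathrm{Id}$ such that: the fibres of $q$ are the orbits of $t$; over $M\setminus L$ the map $q$ is a covering and $\mathrm{Id},t,\dots,t^{k-1}$ act without fixed points except for the identity; and near every point over $L$ there are coordinates $(w,s)\in\mathbb C\times\mathbb R$ on $Y$ and smooth coordinates $(z,s)\in\mathbb C\times\mathbb R$ on $M$, positive for the orientation of $M$ and with $L=\{z=0\}$ oriented by increasing $s$, in which $q(w,s)=(w^k,s)$ and $t(w,s)=(e^{2\pi i/k}w,s)$. Thus every oriented meridian of $L$ corresponds to $t$. For closed 3-manifolds $\tilde N,N$ let $p:\tilde N\to N$ be a map and $\sigma$ an involution of $\tilde N$. For $\chi\in H^1(\tilde N;\mathbb R)$ we say that $(\tilde N,N,\chi)$ is a *$\mathbb Z_3$ symmetric triple* if there is a homeomorphism $\tau:N\to N$ with $\tau^3=\mathrm{Id}$ such that $p$ is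 a double branched covering with involution $\sigma$, branched along $\mathrm{Fix}(\tau)$ (locally $(w,s)\mapsto(w^2,s)$ with $\mathrm{Fix}(\tau)=\{z=0\}$), and there is a lift $\tilde\tau$ of $\tau$ to $\tilde N$ with $\tilde\tau\sigma=\sigma\tilde\tau$, $\sigma^*\chi=-\chi$ and $\tilde\tau^*\chi=\chi$. **Proposition 3.1.** Let $M$ be a closed oriented smooth 3-manifold with $H_*(M;\mathbb Q)\cong H_*(S^3;\mathbb Q)$, let $L\subset M$ be an oriented link, and let $M_6\to M$ be a compact 6-fold cyclic branched cover of $M$ along $L$, with generator $t$. Put $\sigma=t^3$, $\tau=t^2$, $M_2=M_6/\langle\tau\rangle$, $M_3=M_6/\langle\sigma\rangle$, with quotient maps $p_2:M_6\to M_2$, $p_3:M_6\to M_3$, and suppose that $b_1(M_2)=\dim H^1(M_2;\mathbb R)\neq0$. Then: 1. $M_2$ and $M_3$, with the maps to $M$ and the homeomorphisms induced by $q$ and $t$, are a 2-fold and a 3-fold cyclic branched cover of $M$ along $L$. 2. For every $\alpha\in H^1(M_2;\mathbb R)$ the class $\chi=p_2^*\alpha\in H^1(M_6;\mathbb R)$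 satisfies $\sigma^*\chi=-\chi$ and $\tau^*\chi=\chi$, and $(M_6,M_3,\chi)$ (with $p_3$ and $\sigma$) is a $\mathbb Z_3$ symmetric triple. 3. There is an $\alpha\in H^1(M_2;\mathbb R)$ with $p_2^*\alpha\neq0$; in particular there is a nonzero $\chi\in H^1(M_6;\mathbb R)$ such that $(M_6,M_3,\chi)$ is a $\mathbb Z_3$ symmetric triple. -/

import Mathlib

open scoped Manifold ContDiff

noncomputable section

/-! ### Singular cohomology in degree one, rational homology spheres -/

/-- Singular `n`-simplices of `X`. -/
abbrev SingularSimplex (n : ℕ) (X : Type) [TopologicalSpace X] : Type :=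
  C(stdSimplex ℝ (Fin (n + 1)), X)

/-- The inclusion of the `i`-th face (opposite to the `i`-th vertex) of the standard simplex. -/
def simplexFace (n : ℕ) (i : Fin (n + 2)) :
    C(stdSimplex ℝ (Fin (n + 1)), stdSimplex ℝ (Fin (n + 2))) :=
  ⟨stdSimplex.map i.succAbove, stdSimplex.continuous_map i.succAbove⟩

/-- The coboundary `δ : Cⁿ(X; ℝ) → Cⁿ⁺¹(X; ℝ)` of the singular cochain complex. -/
def coboundary (n : ℕ) (X : Type) [TopologicalSpace X] :
    (SingularSimplex n X → ℝ) →ₗ[ℝ] (SingularSimplex (n + 1) X → ℝ) where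
  toFun c := fun s => ∑ i : Fin (n + 2), (-1 : ℝ) ^ (i : ℕ) * c (s.comp (simplexFace n i))
  map_add' c d := by
    funext s
    simp [mul_add, Finset.sum_add_distrib]
  map_smul' r c := by
    funext s
    simp only [Pi.smul_apply, smul_eq_mul, RingHom.id_apply, Finset.mul_sum]
    exact Finset.sum_congr rfl fun i _ => by ring

/-- The first singular cohomology `H¹(X; ℝ)`: cocycles modulo coboundaries. -/
abbrev H1 (X : Type) [TopologicalSpace X] : Type :=
  (LinearMap.ker (coboundary 1 X)) ⧸
    (LinearMap.range (coboundary 0 X)).submoduleOf (LinearMap.ker (coboundary 1 X))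

/-- Pull-back of singular cochains along a continuous map. -/
def cochainPullback (n : ℕ) {X Y : Type} [TopologicalSpace X] [TopologicalSpace Y] (f : C(X, Y)) :
    (SingularSimplex n Y → ℝ) →ₗ[ℝ] (SingularSimplex n X → ℝ) where
  toFun c := fun s => c (f.comp s)
  map_add' _ _ := rfl
  map_smul' _ _ := rfl

theorem coboundary_cochainPullback (n : ℕ) {X Y : Type} [TopologicalSpace X] [TopologicalSpace Y]
    (f : C(X, Y)) (c : SingularSimplex n Y → ℝ) :
    coboundary n X (cochainPullback n f c) = cochainPullback (n + 1) f (coboundary n Y c) := rfl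

/-- Pull-back of cocycles along a continuous map. -/
def cocyclePullback {X Y : Type} [TopologicalSpace X] [TopologicalSpace Y] (f : C(X, Y)) :
    LinearMap.ker (coboundary 1 Y) →ₗ[ℝ] LinearMap.ker (coboundary 1 X) :=
  (cochainPullback 1 f).restrict fun c hc => by
    rw [LinearMap.mem_ker] at hc ⊢
    rw [coboundary_cochainPullback, hc, map_zero]

/-- The pull-back `f^* : H¹(Y; ℝ) → H¹(X; ℝ)` along a continuous map `f : X → Y`. -/
def H1.pullback {X Y : Type} [TopologicalSpace X] [TopologicalSpace Y] (f : C(X, Y)) :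
    H1 Y →ₗ[ℝ] H1 X :=
  Submodule.mapQ _ _ (cocyclePullback f) <| by
    rintro ⟨c, hc⟩ ⟨g, hg⟩
    exact ⟨cochainPullback 0 f g, by
      rw [coboundary_cochainPullback, hg]
      rfl⟩

/-- The first Betti number `b₁(X) = dim H¹(X; ℝ)` (as a cardinal, so that no finiteness is needed
for it to be meaningful). -/
def firstBetti (X : Type) [TopologicalSpace X] : Cardinal := Module.rank ℝ (H1 X)

open CategoryTheory in
/-- `X` has the rational homology of the 3-sphere: `H₀ ≅ H₃ ≅ ℚ` and all other groups vanish. -/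
def HasRationalHomologyOfThreeSphere (X : Type) [TopologicalSpace X] : Prop :=
  ∀ n : ℕ,
    if n = 0 ∨ n = 3 then
      Nonempty (((AlgebraicTopology.singularHomologyFunctor (ModuleCat.{0} ℚ) n).obj
        (ModuleCat.of ℚ ℚ)).obj (TopCat.of X) ≅ ModuleCat.of ℚ ℚ)
    else
      Limits.IsZero (((AlgebraicTopology.singularHomologyFunctor (ModuleCat.{0} ℚ) n).obj
        (ModuleCat.of ℚ ℚ)).obj (TopCat.of X))

/-! ### Oriented smooth 3-manifolds and oriented links

Three-dimensional space is written `ℂ × ℝ`, with its standard orientation. -/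

/-- An orientation of a smooth 3-manifold, given by an oriented smooth atlas: the Jacobian
determinants of all coordinate changes are positive. -/
structure SmoothOrientation (M : Type) [TopologicalSpace M] [ChartedSpace (ℂ × ℝ) M] where
  charts : Set (OpenPartialHomeomorph M (ℂ × ℝ))
  charts_smooth : charts ⊆ IsManifold.maximalAtlas 𝓘(ℝ, ℂ × ℝ) ∞ M
  cover : ∀ x : M, ∃ e ∈ charts, x ∈ e.source
  det_pos : ∀ e ∈ charts, ∀ e' ∈ charts, ∀ x ∈ e.source ∩ e'.source,
    0 < (fderiv ℝ (e' ∘ e.symm) (e x)).det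

/-- An oriented link in an oriented smooth 3-manifold: a closed subset which in suitable smooth
charts, positive for the orientation of the manifold, is the axis `{z = 0}` of `ℂ × ℝ`; the
orientation of the link is the direction of increasing second coordinate in these charts, on which
the charts are required to agree. -/
structure OrientedLink {M : Type} [TopologicalSpace M] [ChartedSpace (ℂ × ℝ) M]
    (o : SmoothOrientation M) where
  carrier : Set M
  isClosed : IsClosed carrier
  charts : Set (OpenPartialHomeomorph M (ℂ × ℝ))
  charts_smooth : charts ⊆ IsManifold.maximalAtlas 𝓘(ℝ, ℂ × ℝ) ∞ M
  cover : ∀ x ∈ carrier, ∃ e ∈ charts, x ∈ e.source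
  det_pos : ∀ e ∈ o.charts, ∀ e' ∈ charts, ∀ x ∈ e.source ∩ e'.source,
    0 < (fderiv ℝ (e' ∘ e.symm) (e x)).det
  slice : ∀ e ∈ charts, ∀ x ∈ e.source, x ∈ carrier ↔ (e x).1 = 0
  direction_pos : ∀ e ∈ charts, ∀ e' ∈ charts, ∀ x ∈ carrier, x ∈ e.source → x ∈ e'.source →
    0 < (fderiv ℝ (e' ∘ e.symm) (e x) (0, 1)).2

/-! ### Cyclic branched coverings -/

/-- `p : Y → N` is a `k`-fold cyclic covering of a 3-dimensional space `N`, branched along `B`, with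
distinguished generator `t` of its group of deck transformations: the fibres of `p` are the orbits
of `t`, which has order `k`; away from `B` the map `p` is a covering on which the group generated by
`t` acts freely; and near each point over `B`, for a chart of `N` from the family `A`, the map `p`
is `(w, s) ↦ (w ^ k, s)` and `t` is `(w, s) ↦ (exp (2πi/k) w, s)`. -/
structure IsCyclicBranchedCovering {Y N : Type} [TopologicalSpace Y] [TopologicalSpace N] (k : ℕ)
    (B : Set N) (A : Set (OpenPartialHomeomorph N (ℂ × ℝ))) (p : Y → N) (t : Y ≃ₜ Y) : Prop where
  t2 : T2Space Y
  continuous : Continuous p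
  surjective : Function.Surjective p
  pow_eq_one : t ^ k = 1
  fibre : ∀ y y' : Y, p y = p y' ↔ ∃ i : ℕ, (t ^ i) y = y'
  free : ∀ y : Y, p y ∉ B → ∀ i : ℕ, 0 < i → i < k → (t ^ i) y ≠ y
  covering : IsCoveringMapOn p Bᶜ
  model : ∀ y : Y, p y ∈ B → ∃ e ∈ A, ∃ ψ : OpenPartialHomeomorph Y (ℂ × ℝ), y ∈ ψ.source ∧
    ∀ y' ∈ ψ.source, p y' ∈ e.source ∧ t y' ∈ ψ.source ∧
      e (p y') = ((ψ y').1 ^ k, (ψ y').2) ∧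
      ψ (t y') = (Complex.exp (2 * Real.pi * Complex.I / k) * (ψ y').1, (ψ y').2)

/-- `q : Y → M`, with deck transformation `t`, is the `k`-fold cyclic branched covering of `M` along
the oriented link `L`: the charts are those adapted to the orientations of `M` and `L`, so that
every oriented meridian of `L` corresponds to the generator `t`. -/
def OrientedLink.IsCyclicBranchedCover {M : Type} [TopologicalSpace M] [ChartedSpace (ℂ × ℝ) M]
    {o : SmoothOrientation M} (L : OrientedLink o) (k : ℕ) {Y : Type} [TopologicalSpace Y]
    (q : Y → M) (t : Y ≃ₜ Y) : Prop :=
  IsCyclicBranchedCovering k L.carrier L.charts q t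

/-- `p : Y → N` is a double branched covering along `B`, with involution `s`; near `B` the charts of
`N` are arbitrary charts in which `B` is `{z = 0}`. -/
def IsDoubleBranchedCover {Y N : Type} [TopologicalSpace Y] [TopologicalSpace N]
    (B : Set N) (p : Y → N) (s : Y ≃ₜ Y) : Prop :=
  IsCyclicBranchedCovering 2 B {e | ∀ x ∈ e.source, x ∈ B ↔ (e x).1 = 0} p s

/-- Closed topological 3-manifolds. -/
structure IsClosedThreeManifold (N : Type) [TopologicalSpace N] : Prop where
  t2 : T2Space N
  compact : CompactSpace N
  chart : ∀ x : N, ∃ e : OpenPartialHomeomorph N (ℂ × ℝ), x ∈ e.source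

/-- `(Y, N, χ)` is a `ℤ/3` symmetric triple, in dimension three. Here `p : Y → N` is the double
branched covering and `s` its involution; there is an action of `ℤ/3` on `N`, generated by `τ`, whose
fixed locus is the branch locus of `p`, and a lift `τ'` of `τ` to `Y` commuting with `s`, such that
`χ` is anti-invariant under `s` and invariant under `τ'`. -/
def IsZ3SymmetricTriple {Y N : Type} [TopologicalSpace Y] [TopologicalSpace N]
    (p : Y → N) (s : Y ≃ₜ Y) (χ : H1 Y) : Prop :=
  IsClosedThreeManifold Y ∧ IsClosedThreeManifold N ∧
  ∃ τ : N ≃ₜ N, τ ^ 3 = 1 ∧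
    IsDoubleBranchedCover {x | τ x = x} p s ∧
    ∃ τ' : Y ≃ₜ Y, (∀ y, p (τ' y) = τ (p y)) ∧ (∀ y, τ' (s y) = s (τ' y)) ∧
      H1.pullback (s : C(Y, Y)) χ = -χ ∧
      H1.pullback (τ' : C(Y, Y)) χ = χ

/-! ### Quotients by powers of a homeomorphism -/

/-- The equivalence relation on `Y` whose classes are the orbits of the group generated by `h`. -/
def orbitSetoid {Y : Type} [TopologicalSpace Y] (h : Y ≃ₜ Y) : Setoid Y where
  r y y' := ∃ i : ℤ, (h ^ i) y = y'
  iseqv :=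
    { refl := fun _ => ⟨0, rfl⟩
      symm := by
        rintro y _ ⟨i, rfl⟩
        exact ⟨-i, by rw [← Homeomorph.mul_apply, ← zpow_add]; simp⟩
      trans := by
        rintro y _ _ ⟨i, rfl⟩ ⟨j, rfl⟩
        exact ⟨j + i, by rw [zpow_add]; rfl⟩ }

/-- The orbit space `Y / ⟨h⟩`, with the quotient topology. -/
def OrbitSpace {Y : Type} [TopologicalSpace Y] (h : Y ≃ₜ Y) : Type := Quotient (orbitSetoid h)

instance {Y : Type} [TopologicalSpace Y] (h : Y ≃ₜ Y) : TopologicalSpace (OrbitSpace h) :=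
  inferInstanceAs (TopologicalSpace (Quotient (orbitSetoid h)))

namespace OrbitSpace

variable {Y : Type} [TopologicalSpace Y]

/-- The quotient map `Y → Y / ⟨h⟩`. -/
def proj (h : Y ≃ₜ Y) : C(Y, OrbitSpace h) :=
  ⟨fun y => Quotient.mk (orbitSetoid h) y, continuous_quotient_mk'⟩

/-- The map `Y / ⟨h⟩ → Z` induced by an `h`-invariant map `Y → Z`. -/
def lift {Z : Type} (h : Y ≃ₜ Y) (q : Y → Z) (hq : ∀ y, q (h y) = q y) : OrbitSpace h → Z :=
  Quotient.lift q <| by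
    have key : ∀ (i : ℕ) (y : Y), q ((h ^ i) y) = q y := by
      intro i
      induction i with
      | zero => intro y; rfl
      | succ i ih => intro y; rw [pow_succ, Homeomorph.mul_apply, ih, hq]
    rintro y _ ⟨i, rfl⟩
    obtain ⟨n, rfl | rfl⟩ := i.eq_nat_or_neg
    · rw [zpow_natCast, key]
    · rw [← key n ((h ^ (-(n : ℤ))) y), ← zpow_natCast h n, ← Homeomorph.mul_apply, ← zpow_add]
      simp

/-- The map induced on `Y / ⟨h⟩` by a homeomorphism commuting with `h`. -/
def map (h g : Y ≃ₜ Y) (hg : Commute g h) : OrbitSpace h → OrbitSpace h :=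
  Quotient.map g <| by
    rintro y _ ⟨i, rfl⟩
    exact ⟨i, by rw [← Homeomorph.mul_apply, ← Homeomorph.mul_apply, (hg.zpow_right i).eq]⟩

theorem continuous_map (h g : Y ≃ₜ Y) (hg : Commute g h) : Continuous (map h g hg) :=
  continuous_quot_lift _ (continuous_quotient_mk'.comp g.continuous)

/-- The homeomorphism induced by `t` on the orbit space `Y / ⟨t ^ m⟩`. -/
def induced (t : Y ≃ₜ Y) (m : ℕ) : OrbitSpace (t ^ m) ≃ₜ OrbitSpace (t ^ m) where
  toFun := map (t ^ m) t (Commute.self_pow t m)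
  invFun := map (t ^ m) t⁻¹ (Commute.self_pow t m).inv_left
  left_inv := by
    rintro ⟨y⟩
    exact congrArg (Quotient.mk (orbitSetoid (t ^ m))) (t.symm_apply_apply y)
  right_inv := by
    rintro ⟨y⟩
    exact congrArg (Quotient.mk (orbitSetoid (t ^ m))) (t.apply_symm_apply y)
  continuous_toFun := continuous_map _ _ _
  continuous_invFun := continuous_map _ _ _

end OrbitSpace

/-- The map `Y / ⟨t ^ m⟩ → M` induced by a cyclic branched covering `q : Y → M`. -/
def OrientedLink.IsCyclicBranchedCover.quotientMap {M : Type} [TopologicalSpace M]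
    [ChartedSpace (ℂ × ℝ) M] {o : SmoothOrientation M} {L : OrientedLink o} {k : ℕ}
    {Y : Type} [TopologicalSpace Y] {q : Y → M} {t : Y ≃ₜ Y}
    (hq : L.IsCyclicBranchedCover k q t) (m : ℕ) : OrbitSpace (t ^ m) → M :=
  OrbitSpace.lift (t ^ m) q fun y => ((hq.fibre y ((t ^ m) y)).2 ⟨m, rfl⟩).symm

end

/-!
The heart of the matter is that `t ^ 3` acts on the classes pulled back from `M₂` by `-1`. It covers
the deck transformation `t₂` of `M₂ → M`, so it is enough that `t₂^* α = -α` for `α ∈ H¹(M₂; ℝ)`,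
that is, that the invariant class `α + t₂^* α` vanishes. This holds because, with real coefficients,
an invariant class of a cyclic branched covering descends to the base, and `H¹(M; ℝ) = 0`.

The descent (`IsTameCyclicQuotient.exists_isPrimitive`) does not lift paths of the base, which
near the branch locus may be wild. An invariant cocycle has, near each fibre, a primitive that is
constant on fibres (average a primitive over the group). These primitives descend to functions on
open subsets of the base that differ by locally constant functions on overlaps: a multivalued
function. Its germs form a covering space with discrete fibre `ℝ`; lifting singular simplices to
this covering space gives a singular cocycle on the base
(`MultivaluedFunction.exists_global_branch`). If that cocycle is exact, the multivalued function
has a single-valued branch, whose composition with the projection is a primitive of the given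
cocycle. Exactness on `M` is the universal coefficient theorem in degree one,
`exists_isPrimitive_of_isZero_homology`.

The same averaging shows that the pull-back to a cyclic branched covering is injective on `H¹`
(`IsTameCyclicQuotient.exists_isPrimitive_of_pullback`): average a primitive of the pulled-back
cocycle and descend it. Hence nonzero classes of `M₂` stay nonzero on `M₆`.

The topological statements rest on one chart: where `t` is the rotation of `w` by `2π/(mn)`, the map
`(w, s) ↦ (w ^ n, s)` induces a chart of the orbit space of `t ^ m`
(`IsCyclicBranchedCovering.exists_quotientChart`). Away from the branch locus the maps between the
orbit spaces are local homeomorphisms of compact Hausdorff spaces, hence coverings. The branch locus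
of `M₆ → M₃` is the fixed locus of the automorphism of `M₃` induced by `t ^ 2`.
-/

noncomputable section

/-! ### Singular one-cocycles and their primitives -/

open unitInterval Topology

variable {X : Type} [TopologicalSpace X]

/-- The `i`-th vertex of the standard 1-simplex. -/
abbrev edgeVertex (i : Fin 2) : stdSimplex ℝ (Fin (1 + 1)) := stdSimplex.vertex i

/-- `f` is a primitive of the 1-cochain `c` on the subset `V`: the value of `c` on each path in `V`
is the increment of `f` along the path. -/
def IsPrimitiveOn (c : SingularSimplex 1 X → ℝ) (f : X → ℝ) (V : Set X) : Prop :=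
  ∀ γ : SingularSimplex 1 X, (∀ x, γ x ∈ V) → c γ = f (γ (edgeVertex 1)) - f (γ (edgeVertex 0))

/-- `f` is a primitive of the 1-cochain `c`, that is, `c = δf`. -/
def IsPrimitive (c : SingularSimplex 1 X → ℝ) (f : X → ℝ) : Prop :=
  ∀ γ : SingularSimplex 1 X, c γ = f (γ (edgeVertex 1)) - f (γ (edgeVertex 0))

theorem IsPrimitiveOn.mono {c : SingularSimplex 1 X → ℝ} {f : X → ℝ} {V W : Set X}
    (h : IsPrimitiveOn c f V) (hWV : W ⊆ V) : IsPrimitiveOn c f W :=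
  fun γ hγ => h γ fun x => hWV (hγ x)

theorem comp_simplexFace_eq_const (γ : SingularSimplex 1 X) (i : Fin 2) :
    γ.comp (simplexFace 0 i) = .const _ (γ (edgeVertex (i.succAbove 0))) := by
  ext x
  have hx : x = stdSimplex.vertex 0 := Subsingleton.elim _ _
  subst hx
  exact congrArg γ (stdSimplex.map_vertex _ _)

theorem coboundary_zero_apply (f : SingularSimplex 0 X → ℝ) (γ : SingularSimplex 1 X) :
    coboundary 0 X f γ =
      f (.const _ (γ (edgeVertex 1))) - f (.const _ (γ (edgeVertex 0))) := by
  simp only [coboundary, LinearMap.coe_mk, AddHom.coe_mk, comp_simplexFace_eq_const]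
  simp [sub_eq_add_neg]

theorem mem_range_coboundary_iff {c : SingularSimplex 1 X → ℝ} :
    c ∈ LinearMap.range (coboundary 0 X) ↔ ∃ f, IsPrimitive c f := by
  constructor
  · rintro ⟨f, rfl⟩
    exact ⟨fun x => f (.const _ x), fun γ => coboundary_zero_apply f γ⟩
  · rintro ⟨f, hf⟩
    refine ⟨fun s => f (s (stdSimplex.vertex 0)), ?_⟩
    funext γ
    rw [coboundary_zero_apply, hf γ]
    rfl

theorem H1.mk_eq_zero_iff {c : LinearMap.ker (coboundary 1 X)} :
    (Submodule.Quotient.mk c : H1 X) = 0 ↔ ∃ f, IsPrimitive c.1 f := by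
  rw [Submodule.Quotient.mk_eq_zero, Submodule.submoduleOf, Submodule.mem_comap,
    Submodule.subtype_apply, mem_range_coboundary_iff]

theorem coboundary_one_apply (c : SingularSimplex 1 X → ℝ) (s : SingularSimplex 2 X) :
    coboundary 1 X c s = c (s.comp (simplexFace 1 0)) - c (s.comp (simplexFace 1 1)) +
      c (s.comp (simplexFace 1 2)) := by
  change ∑ i : Fin 3, (-1 : ℝ) ^ (i : ℕ) * c (s.comp (simplexFace 1 i)) = _
  rw [Fin.sum_univ_three]
  simp [sub_eq_add_neg]

theorem coboundary_one_eq_zero {c : SingularSimplex 1 X → ℝ} (hc : coboundary 1 X c = 0)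
    (s : SingularSimplex 2 X) :
    c (s.comp (simplexFace 1 0)) - c (s.comp (simplexFace 1 1)) +
      c (s.comp (simplexFace 1 2)) = 0 := by
  rw [← coboundary_one_apply, hc, Pi.zero_apply]

theorem cocycle_const {c : SingularSimplex 1 X → ℝ} (hc : coboundary 1 X c = 0) (x : X) :
    c (.const _ x) = 0 := by
  have := coboundary_one_eq_zero hc (.const _ x)
  simpa only [ContinuousMap.const_comp, sub_self, zero_add] using this

theorem stdSimplex_map_const {n : ℕ} (i : Fin 2) (x : stdSimplex ℝ (Fin (n + 1))) :
    stdSimplex.map (fun _ => i) x = edgeVertex i := by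
  have h : (fun _ : Fin (n + 1) => i) = (fun _ : Fin 1 => i) ∘ (fun _ => 0) := rfl
  rw [h, ← stdSimplex.map_comp_apply,
    Subsingleton.elim (stdSimplex.map (fun _ => (0 : Fin 1)) x) (stdSimplex.vertex 0),
    stdSimplex.map_vertex]

/-- The singular 2-simplex of `X` obtained from a square `K : Δ¹ × Δ¹ → X` and two maps
`Δ² → Δ¹` prescribed on the vertices. -/
def squareTriangle (K : C(stdSimplex ℝ (Fin 2) × stdSimplex ℝ (Fin 2), X)) (a b : Fin 3 → Fin 2) :
    SingularSimplex 2 X :=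
  K.comp ((⟨stdSimplex.map a, stdSimplex.continuous_map a⟩ : C(_, _)).prodMk
    ⟨stdSimplex.map b, stdSimplex.continuous_map b⟩)

theorem squareTriangle_face (K : C(stdSimplex ℝ (Fin 2) × stdSimplex ℝ (Fin 2), X))
    (a b : Fin 3 → Fin 2) (i : Fin 3) (x : stdSimplex ℝ (Fin 2)) :
    (squareTriangle K a b).comp (simplexFace 1 i) x =
      K (stdSimplex.map (a ∘ i.succAbove) x, stdSimplex.map (b ∘ i.succAbove) x) := by
  rw [← stdSimplex.map_comp_apply, ← stdSimplex.map_comp_apply]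
  rfl

/-- The two triangles of a square `K`: a 1-cocycle takes the same value on both ways round. -/
theorem cocycle_square {c : SingularSimplex 1 X → ℝ} (hc : coboundary 1 X c = 0)
    (K : C(stdSimplex ℝ (Fin 2) × stdSimplex ℝ (Fin 2), X)) :
    c (K.comp (.prodMk (.id _) (.const _ (edgeVertex 0)))) +
        c (K.comp (.prodMk (.const _ (edgeVertex 1)) (.id _))) =
      c (K.comp (.prodMk (.const _ (edgeVertex 0)) (.id _))) +
        c (K.comp (.prodMk (.id _) (.const _ (edgeVertex 1)))) := by
  have h₁ := coboundary_one_eq_zero hc (squareTriangle K ![0, 1, 1] ![0, 0, 1])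
  have h₂ := coboundary_one_eq_zero hc (squareTriangle K ![0, 0, 1] ![0, 1, 1])
  have e (a b : Fin 3 → Fin 2) (i : Fin 3) (g : C(stdSimplex ℝ (Fin 2), _))
      (h : ∀ x, g x = (stdSimplex.map (a ∘ i.succAbove) x, stdSimplex.map (b ∘ i.succAbove) x)) :
      (squareTriangle K a b).comp (simplexFace 1 i) = K.comp g := by
    ext x
    rw [squareTriangle_face, ContinuousMap.comp_apply, h]
  have cst (i : Fin 2) (f : Fin 2 → Fin 2) (hf : f = fun _ => i) (x : stdSimplex ℝ (Fin 2)) :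
      stdSimplex.map f x = edgeVertex i := hf ▸ stdSimplex_map_const i x
  have idn (f : Fin 2 → Fin 2) (hf : f = id) (x : stdSimplex ℝ (Fin 2)) :
      stdSimplex.map f x = x := hf ▸ stdSimplex.map_id_apply x
  rw [e _ _ 0 (.prodMk (.const _ (edgeVertex 1)) (.id _)) fun x => Prod.ext
      (cst 1 _ (by decide) x).symm (idn _ (by decide) x).symm,
    e _ _ 1 (.prodMk (.id _) (.id _)) fun x => Prod.ext
      (idn _ (by decide) x).symm (idn _ (by decide) x).symm,
    e _ _ 2 (.prodMk (.id _) (.const _ (edgeVertex 0))) fun x => Prod.ext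
      (idn _ (by decide) x).symm (cst 0 _ (by decide) x).symm] at h₁
  rw [e _ _ 0 (.prodMk (.id _) (.const _ (edgeVertex 1))) fun x => Prod.ext
      (idn _ (by decide) x).symm (cst 1 _ (by decide) x).symm,
    e _ _ 1 (.prodMk (.id _) (.id _)) fun x => Prod.ext
      (idn _ (by decide) x).symm (idn _ (by decide) x).symm,
    e _ _ 2 (.prodMk (.const _ (edgeVertex 0)) (.id _)) fun x => Prod.ext
      (cst 0 _ (by decide) x).symm (idn _ (by decide) x).symm] at h₂
  linarith

/-- The first cohomology of a contractible space vanishes: integrate along the tracks of a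
contraction. -/
theorem exists_isPrimitive_of_contractible [ContractibleSpace X] {c : SingularSimplex 1 X → ℝ}
    (hc : coboundary 1 X c = 0) : ∃ f, IsPrimitive c f := by
  obtain ⟨x₀, ⟨H⟩⟩ := id_nullhomotopic X
  let τ : C(stdSimplex ℝ (Fin 2), I) :=
    ⟨fun y => ⟨y 0, stdSimplex.zero_le y 0, stdSimplex.le_one y 0⟩,
      ((continuous_apply 0).comp continuous_subtype_val).subtype_mk _⟩
  have τ₀ : τ (edgeVertex 0) = 1 := Subtype.ext (by simp [τ])
  have τ₁ : τ (edgeVertex 1) = 0 := Subtype.ext (by simp [τ])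
  let track (x : X) : SingularSimplex 1 X := H.toContinuousMap.comp (τ.prodMk (.const _ x))
  refine ⟨fun x => c (track x), fun γ => ?_⟩
  have h := cocycle_square hc (H.toContinuousMap.comp (τ.prodMap γ))
  have e₁ : (H.toContinuousMap.comp (τ.prodMap γ)).comp
      (.prodMk (.const _ (edgeVertex 1)) (.id _)) = γ := by
    ext y; simp [τ₁]
  have e₂ : (H.toContinuousMap.comp (τ.prodMap γ)).comp
      (.prodMk (.const _ (edgeVertex 0)) (.id _)) = .const _ x₀ := by
    ext y; simp [τ₀]
  rw [e₁, e₂, cocycle_const hc] at h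
  have e₃ (i : Fin 2) : (H.toContinuousMap.comp (τ.prodMap γ)).comp
      (.prodMk (.id _) (.const _ (edgeVertex i))) = track (γ (edgeVertex i)) := rfl
  rw [e₃, e₃] at h
  linarith

theorem exists_isPrimitiveOn_of_contractible {V : Set X} [ContractibleSpace V]
    {c : SingularSimplex 1 X → ℝ} (hc : coboundary 1 X c = 0) : ∃ f, IsPrimitiveOn c f V := by
  classical
  let ι : C(V, X) := ⟨Subtype.val, continuous_subtype_val⟩
  obtain ⟨f, hf⟩ := exists_isPrimitive_of_contractible (X := V) (c := cochainPullback 1 ι c)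
    (by rw [coboundary_cochainPullback, hc, map_zero])
  refine ⟨fun x => if h : x ∈ V then f ⟨x, h⟩ else 0, fun γ hγ => ?_⟩
  have := hf ⟨fun x => ⟨γ x, hγ x⟩, γ.continuous.subtype_mk _⟩
  simp only [hγ, dif_pos]
  exact this

theorem JoinedIn.exists_singularSimplex {W : Set X} {a b : X} (h : JoinedIn W a b) :
    ∃ γ : SingularSimplex 1 X, (∀ x, γ x ∈ W) ∧ γ (edgeVertex 0) = a ∧ γ (edgeVertex 1) = b := by
  obtain ⟨p, hp⟩ := h
  refine ⟨p.toContinuousMap.comp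
    ⟨stdSimplexHomeomorphUnitInterval, stdSimplexHomeomorphUnitInterval.continuous⟩,
    fun x => hp _, ?_, ?_⟩
  · exact (congrArg p stdSimplexHomeomorphUnitInterval_zero).trans p.source
  · exact (congrArg p stdSimplexHomeomorphUnitInterval_one).trans p.target

/-- Two primitives of the same cochain differ by a locally constant function. -/
theorem IsPrimitiveOn.eventually_sub_eq [LocallyPathConnectedSpace X]
    {c : SingularSimplex 1 X → ℝ} {f g : X → ℝ} {W : Set X} (hf : IsPrimitiveOn c f W)
    (hg : IsPrimitiveOn c g W) {x : X} (hW : W ∈ 𝓝 x) : ∀ᶠ y in 𝓝 x, f y - g y = f x - g x := by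
  filter_upwards [pathComponentIn_mem_nhds hW] with y hy
  obtain ⟨γ, hγ, h₀, h₁⟩ := JoinedIn.exists_singularSimplex hy
  have h := (hf γ hγ).symm.trans (hg γ hγ)
  rw [h₀, h₁] at h
  linarith

instance Convex.locallyPathConnectedSpace_stdSimplex (n : ℕ) :
    LocallyPathConnectedSpace (stdSimplex ℝ (Fin n)) := by
  refine .of_bases (p := fun _ r => 0 < r) (s := fun x r => Metric.ball x r)
    (fun x => Metric.nhds_basis_ball) fun x r hr => ?_
  have h : IsPathConnected (Metric.ball (x : Fin n → ℝ) r ∩ stdSimplex ℝ (Fin n)) :=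
    ((convex_ball _ _).inter (convex_stdSimplex ℝ _)).isPathConnected
      ⟨x, Metric.mem_ball_self hr, x.2⟩
  have e : Metric.ball x r = ((↑) : stdSimplex ℝ (Fin n) → (Fin n → ℝ)) ⁻¹'
      (Metric.ball (x : Fin n → ℝ) r ∩ stdSimplex ℝ (Fin n)) := by
    ext y
    exact ⟨fun h => ⟨h, y.2⟩, fun h => h.1⟩
  rw [e]
  exact h.preimage_coe Set.inter_subset_right

instance contractibleSpace_stdSimplex (n : ℕ) :
    ContractibleSpace (stdSimplex ℝ (Fin (n + 1))) :=
  (convex_stdSimplex ℝ _).contractibleSpace ⟨_, single_mem_stdSimplex ℝ 0⟩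

end

noncomputable section

/-! ### Multivalued functions -/

open Topology

/-- A multivalued function on `N`, single-valued up to additive constants: each point `i` has a
neighbourhood `dom i` with a function `fn i` on it, and on overlaps these functions differ by
locally constant functions. Values of `fn i` outside `dom i` are irrelevant. -/
structure MultivaluedFunction (N : Type) [TopologicalSpace N] where
  dom : N → Set N
  isOpen_dom : ∀ i, IsOpen (dom i)
  mem_dom : ∀ i, i ∈ dom i
  fn : N → N → ℝ
  compat : ∀ i j, ∀ x ∈ dom i ∩ dom j, ∀ᶠ y in 𝓝 x, fn i y - fn j y = fn i x - fn j x

/-- The real line with the discrete topology. -/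
structure DiscreteReal where
  val : ℝ

instance : TopologicalSpace DiscreteReal := ⊥

instance : DiscreteTopology DiscreteReal := ⟨rfl⟩

namespace MultivaluedFunction

variable {N : Type} [TopologicalSpace N] (D : MultivaluedFunction N)
variable {A B : Type} [TopologicalSpace A] [TopologicalSpace B]

/-- `h : A → ℝ` is a branch, along `g : A → N`, of the multivalued function `D`: locally it differs
from the functions defining `D` by constants. -/
def IsBranch (g : A → N) (h : A → ℝ) : Prop :=
  ∀ a i, g a ∈ D.dom i → ∀ᶠ b in 𝓝 a, h b - D.fn i (g b) = h a - D.fn i (g a)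

variable {D}

theorem IsBranch.comp {g : A → N} {h : A → ℝ} (hh : D.IsBranch g h) (k : C(B, A)) :
    D.IsBranch (g ∘ k) (h ∘ k) :=
  fun b i hb => (k.continuous.tendsto b).eventually (hh (k b) i hb)

theorem IsBranch.sub_eq_sub [PreconnectedSpace A] {g : A → N} {h k : A → ℝ}
    (hh : D.IsBranch g h) (hk : D.IsBranch g k) (a b : A) : h a - h b = k a - k b := by
  have hl : IsLocallyConstant fun a => h a - k a := by
    rw [IsLocallyConstant.iff_eventually_eq]
    intro a
    filter_upwards [hh a (g a) (D.mem_dom _), hk a (g a) (D.mem_dom _)] with b h₁ h₂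
    linarith
  have := hl.apply_eq_of_preconnectedSpace a b
  linarith

variable (D)

/-- The bundle over `N`, with fibre the discrete real line, of germs of branches of `D`. A branch
takes in the chart `i` the value `h - fn i`. -/
def germBundle : FiberBundleCore N N DiscreteReal where
  baseSet := D.dom
  isOpen_baseSet := D.isOpen_dom
  indexAt := id
  mem_baseSet_at := D.mem_dom
  coordChange i j x v := ⟨v.val + D.fn i x - D.fn j x⟩
  coordChange_self i x _ v := by simp
  continuousOn_coordChange i j := by
    rintro ⟨x, v⟩ ⟨hx, -⟩
    have h : (fun p : N × DiscreteReal => (⟨p.2.val + D.fn i p.1 - D.fn j p.1⟩ : DiscreteReal))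
        =ᶠ[𝓝 (x, v)] fun _ => ⟨v.val + D.fn i x - D.fn j x⟩ := by
      rw [nhds_prod_eq, nhds_discrete DiscreteReal, Filter.prod_pure]
      refine Filter.eventually_map.2 ?_
      filter_upwards [D.compat i j x hx] with y hy
      congr 1
      linarith
    exact (continuousAt_const.congr h.symm).continuousWithinAt
  coordChange_comp i j k x _ v := by simp

theorem isCoveringMap_germBundle : IsCoveringMap D.germBundle.proj :=
  FiberBundle.isCoveringMap (F := DiscreteReal) (E := D.germBundle.Fiber)

/-- Along maps from simply connected spaces, multivalued functions have branches: lift the map to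
the covering space of germs. -/
theorem exists_isBranch [SimplyConnectedSpace A] [LocallyPathConnectedSpace A] (g : C(A, N)) :
    ∃ h, D.IsBranch g h := by
  obtain ⟨a₀⟩ : Nonempty A := inferInstance
  obtain ⟨G, ⟨-, hG⟩, -⟩ := D.isCoveringMap_germBundle.existsUnique_continuousMap_lifts g a₀
    (⟨g a₀, (⟨0⟩ : DiscreteReal)⟩ : D.germBundle.TotalSpace) rfl
  have hG' (a : A) : (G a).1 = g a := congrFun hG a
  let v (a : A) : DiscreteReal := (G a).2
  refine ⟨fun a => (v a).val + D.fn (g a) (g a), fun a i ha => ?_⟩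
  have hmem : G a ∈ (D.germBundle.localTriv i).source := by
    rw [FiberBundleCore.mem_localTriv_source]
    exact (hG' a).symm ▸ ha
  have hc : ContinuousAt (fun b => (D.germBundle.localTriv i (G b)).2) a :=
    continuous_snd.continuousAt.comp
      (((D.germBundle.localTriv i).continuousAt hmem).comp G.continuous.continuousAt)
  have hval (b : A) : (D.germBundle.localTriv i (G b)).2.val =
      (v b).val + D.fn (g b) (g b) - D.fn i (g b) := by
    rw [FiberBundleCore.localTriv_apply, ← hG' b]
    rfl
  rw [ContinuousAt, nhds_discrete DiscreteReal, Filter.tendsto_pure] at hc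
  filter_upwards [hc] with b hb
  rw [← hval, ← hval, hb]

/-- If the first cohomology of `N` vanishes, every multivalued function has a single-valued
branch. -/
theorem exists_global_branch
    (hN : ∀ c : SingularSimplex 1 N → ℝ, coboundary 1 N c = 0 → ∃ f, IsPrimitive c f) :
    ∃ F : N → ℝ, ∀ (γ : SingularSimplex 1 N) (h), D.IsBranch γ h →
      h (edgeVertex 1) - h (edgeVertex 0) = F (γ (edgeVertex 1)) - F (γ (edgeVertex 0)) := by
  choose b hb using fun γ : SingularSimplex 1 N => D.exists_isBranch γ
  obtain ⟨F, hF⟩ := hN (fun γ => b γ (edgeVertex 1) - b γ (edgeVertex 0)) <| by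
    funext s
    rw [coboundary_one_apply]
    obtain ⟨k, hk⟩ := D.exists_isBranch s
    have key (i : Fin 3) :
        b (s.comp (simplexFace 1 i)) (edgeVertex 1) - b (s.comp (simplexFace 1 i)) (edgeVertex 0) =
        k (stdSimplex.vertex (i.succAbove 1)) - k (stdSimplex.vertex (i.succAbove 0)) := by
      rw [(hb _).sub_eq_sub (hk.comp (simplexFace 1 i))]
      exact congrArg₂ (k · - k ·) (stdSimplex.map_vertex _ _) (stdSimplex.map_vertex _ _)
    have h₀ := key 0
    have h₁ := key 1
    have h₂ := key 2
    simp only [show (0 : Fin 3).succAbove (1 : Fin 2) = 2 from rfl,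
      show (0 : Fin 3).succAbove (0 : Fin 2) = 1 from rfl,
      show (1 : Fin 3).succAbove (1 : Fin 2) = 2 from rfl,
      show (1 : Fin 3).succAbove (0 : Fin 2) = 0 from rfl,
      show (2 : Fin 3).succAbove (1 : Fin 2) = 1 from rfl,
      show (2 : Fin 3).succAbove (0 : Fin 2) = 0 from rfl] at h₀ h₁ h₂
    rw [h₀, h₁, h₂, Pi.zero_apply]
    ring
  exact ⟨F, fun γ h hh => by rw [hh.sub_eq_sub (hb γ), ← hF γ]⟩

end MultivaluedFunction

end

noncomputable section

/-! ### Universal coefficients in degree one -/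

open CategoryTheory AlgebraicTopology Simplicial

variable {X : Type} [TopologicalSpace X]

/-- The simplices of Mathlib's singular simplicial set of `X` are the singular simplices of `X`. -/
def ofSSetSimplex {n : ℕ} :
    (TopCat.toSSet.obj (TopCat.of X)) _⦋n⦌ ≃ SingularSimplex n X :=
  TopCat.toSSetObjEquiv (TopCat.of X) _

theorem ofSSetSimplex_δ {n : ℕ} (x : (TopCat.toSSet.obj (TopCat.of X)) _⦋n + 1⦌) (i : Fin (n + 2)) :
    ofSSetSimplex ((TopCat.toSSet.obj (TopCat.of X)).δ i x) =
      (ofSSetSimplex x).comp (simplexFace n i) := rfl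

/-- The `ℚ`-linear extension of a real cochain to the rational singular chains. -/
def cochainHom {n : ℕ} (c : SingularSimplex n X → ℝ) :
    ((TopCat.toSSet.obj (TopCat.of X)).chainComplex (ModuleCat.of ℚ ℚ)).X n ⟶ ModuleCat.of ℚ ℝ :=
  Limits.Cofan.IsColimit.desc
    ((TopCat.toSSet.obj (TopCat.of X)).isColimitChainComplexXCofan (ModuleCat.of ℚ ℚ) n)
    fun x => ModuleCat.ofHom (LinearMap.toSpanSingleton ℚ ℝ (c (ofSSetSimplex x)))

theorem ι_cochainHom {n : ℕ} (c : SingularSimplex n X → ℝ)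
    (x : (TopCat.toSSet.obj (TopCat.of X)) _⦋n⦌) :
    (TopCat.toSSet.obj (TopCat.of X)).ιChainComplex x ≫ cochainHom c =
      ModuleCat.ofHom (LinearMap.toSpanSingleton ℚ ℝ (c (ofSSetSimplex x))) :=
  Limits.Cofan.IsColimit.fac
    ((TopCat.toSSet.obj (TopCat.of X)).isColimitChainComplexXCofan (ModuleCat.of ℚ ℚ) n) _ x

theorem d_cochainHom {n : ℕ} (c : SingularSimplex n X → ℝ) :
    ((TopCat.toSSet.obj (TopCat.of X)).chainComplex (ModuleCat.of ℚ ℚ)).d (n + 1) n ≫ cochainHom c =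
      cochainHom (coboundary n X c) := by
  refine SSet.chainComplex_hom_ext fun x => ?_
  rw [SSet.ιChainComplex_d_assoc, ι_cochainHom]
  simp only [Preadditive.sum_comp, Preadditive.zsmul_comp, ι_cochainHom, ofSSetSimplex_δ]
  ext
  simp [coboundary, ModuleCat.hom_sum, zsmul_eq_mul]

theorem cochainHom_injective {n : ℕ} :
    Function.Injective (cochainHom : (SingularSimplex n X → ℝ) → _) := by
  intro c c' h
  funext s
  obtain ⟨x, rfl⟩ := ofSSetSimplex.surjective s
  have := ι_cochainHom c x
  rw [h, ι_cochainHom] at this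
  simpa using (LinearMap.congr_fun (congrArg ModuleCat.Hom.hom this) 1).symm

/-- If `H₁(X; ℚ) = 0` then `H¹(X; ℝ) = 0`: a cocycle extends to a linear form on chains that
vanishes on boundaries, hence on cycles, and therefore factors through the boundary operator. -/
theorem exists_isPrimitive_of_isZero_homology
    (h : Limits.IsZero (((singularHomologyFunctor (ModuleCat.{0} ℚ) 1).obj
        (ModuleCat.of ℚ ℚ)).obj (TopCat.of X)))
    {c : SingularSimplex 1 X → ℝ} (hc : coboundary 1 X c = 0) : ∃ f, IsPrimitive c f := by
  rw [← mem_range_coboundary_iff]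
  let K := (TopCat.toSSet.obj (TopCat.of X)).chainComplex (ModuleCat.of ℚ ℚ)
  have hK : K.ExactAt 1 := by
    rw [HomologicalComplex.exactAt_iff_isZero_homology]
    exact h
  have hex : Function.Exact (K.d 2 1).hom (K.d 1 0).hom := by
    rw [K.exactAt_iff' 2 1 0 (by simp) (by simp)] at hK
    exact (ShortComplex.ShortExact.moduleCat_exact_iff_function_exact _).1 hK
  have hker : LinearMap.ker (K.d 1 0).hom ≤ LinearMap.ker (cochainHom c).hom := by
    intro z hz
    obtain ⟨w, rfl⟩ := (hex z).1 hz
    have h0 : K.d 2 1 ≫ cochainHom c = 0 := by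
      rw [d_cochainHom, hc]
      refine SSet.chainComplex_hom_ext fun x => ?_
      rw [ι_cochainHom]
      ext
      simp
    exact congrArg (fun f => f.hom w) h0
  obtain ⟨ψ, hψ⟩ := LinearMap.exists_extend
    ((LinearMap.ker (K.d 1 0).hom).liftQ (cochainHom c).hom hker ∘ₗ
      (K.d 1 0).hom.quotKerEquivRange.symm.toLinearMap)
  have hψ' (z) : ψ ((K.d 1 0).hom z) = (cochainHom c).hom z := by
    have := LinearMap.congr_fun hψ ⟨(K.d 1 0).hom z, z, rfl⟩
    refine this.trans ?_
    have e : (K.d 1 0).hom.quotKerEquivRange.symm ⟨(K.d 1 0).hom z, z, rfl⟩ =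
        Submodule.Quotient.mk z := by
      rw [LinearEquiv.symm_apply_eq]
      rfl
    simp [e]
  let f (s : SingularSimplex 0 X) : ℝ :=
    ψ (((TopCat.toSSet.obj (TopCat.of X)).ιChainComplex (R := ModuleCat.of ℚ ℚ)
      (ofSSetSimplex.symm s)).hom (1 : ℚ))
  have hf : ModuleCat.ofHom ψ = cochainHom f := by
    refine SSet.chainComplex_hom_ext fun x => ?_
    rw [ι_cochainHom]
    ext
    simp [f, K]
  refine ⟨f, cochainHom_injective ?_⟩
  rw [← d_cochainHom, ← hf]
  ext z
  exact hψ' z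

end

noncomputable section

/-! ### Transfer for tame cyclic quotients -/

open Topology

/-- `p : Y → N` is the quotient by the action of a cyclic group of order dividing `k`, generated by
`t`, and each point of `Y` has a contractible open neighbourhood which is either invariant under the
action or mapped injectively by `p`. -/
structure IsTameCyclicQuotient {Y N : Type} [TopologicalSpace Y] [TopologicalSpace N] (k : ℕ)
    (p : C(Y, N)) (t : Y ≃ₜ Y) : Prop where
  pos : 0 < k
  surjective : Function.Surjective p
  isOpenMap : IsOpenMap p
  pow_eq_one : t ^ k = 1
  fibre : ∀ y y' : Y, p y = p y' ↔ ∃ i : ℕ, (t ^ i) y = y'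
  exists_nhd : ∀ y : Y, ∃ V : Set Y, IsOpen V ∧ y ∈ V ∧ ContractibleSpace V ∧
    ((∀ v ∈ V, t v ∈ V) ∨ Set.InjOn p V)

variable {Y N : Type} [TopologicalSpace Y] [TopologicalSpace N]

/-- The average of the function `f` over `k` iterates of `t`. -/
def iterateAverage (k : ℕ) (t : Y ≃ₜ Y) (f : Y → ℝ) (y : Y) : ℝ :=
  (∑ i ∈ Finset.range k, f ((t ^ i) y)) / k

theorem iterateAverage_apply_self {k : ℕ} {t : Y ≃ₜ Y} (ht : t ^ k = 1) (f : Y → ℝ) (y : Y) :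
    iterateAverage k t f (t y) = iterateAverage k t f y := by
  have h (i : ℕ) : (t ^ i) (t y) = (t ^ (i + 1)) y := by rw [pow_succ]; rfl
  simp only [iterateAverage, h]
  congr 1
  have := Finset.sum_range_succ (fun i => f ((t ^ i) y)) k
  rw [Finset.sum_range_succ', ht] at this
  simpa using this

theorem iterateAverage_apply_pow {k : ℕ} {t : Y ≃ₜ Y} (ht : t ^ k = 1) (f : Y → ℝ) (i : ℕ) (y : Y) :
    iterateAverage k t f ((t ^ i) y) = iterateAverage k t f y := by
  induction i with
  | zero => rfl
  | succ i ih => rw [pow_succ', Homeomorph.mul_apply, iterateAverage_apply_self ht, ih]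

theorem cochain_pow_comp {c : SingularSimplex 1 Y → ℝ} {t : Y ≃ₜ Y}
    (hc : ∀ γ, c ((t : C(Y, Y)).comp γ) = c γ) (i : ℕ) (γ : SingularSimplex 1 Y) :
    c (((t ^ i : Y ≃ₜ Y) : C(Y, Y)).comp γ) = c γ := by
  induction i with
  | zero => rfl
  | succ i ih =>
    rw [← ih, ← hc (((t ^ i : Y ≃ₜ Y) : C(Y, Y)).comp γ), pow_succ']
    rfl

theorem IsPrimitiveOn.iterateAverage {k : ℕ} (hk : 0 < k) {c : SingularSimplex 1 Y → ℝ}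
    {t : Y ≃ₜ Y} (hc : ∀ γ, c ((t : C(Y, Y)).comp γ) = c γ) {f : Y → ℝ} {V : Set Y}
    (hV : ∀ v ∈ V, t v ∈ V) (hf : IsPrimitiveOn c f V) :
    IsPrimitiveOn c (iterateAverage k t f) V := by
  intro γ hγ
  have hV' (i : ℕ) : ∀ v ∈ V, (t ^ i) v ∈ V := by
    induction i with
    | zero => exact fun v hv => hv
    | succ i ih => exact fun v hv => by rw [pow_succ']; exact hV _ (ih v hv)
  have h (i : ℕ) : c γ = f ((t ^ i) (γ (edgeVertex 1))) - f ((t ^ i) (γ (edgeVertex 0))) := by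
    rw [← cochain_pow_comp hc i]
    exact hf _ fun x => hV' i _ (hγ x)
  have hk' : (k : ℝ) ≠ 0 := by positivity
  rw [_root_.iterateAverage, _root_.iterateAverage, ← sub_div, ← Finset.sum_sub_distrib,
    Finset.sum_congr rfl fun i _ => (h i).symm]
  simp [hk']

theorem IsPrimitiveOn.comp_preimage {c : SingularSimplex 1 N → ℝ} {f : N → ℝ} {U : Set N}
    (hf : IsPrimitiveOn c f U) (p : C(Y, N)) :
    IsPrimitiveOn (cochainPullback 1 p c) (f ∘ p) (p ⁻¹' U) :=
  fun γ hγ => hf (p.comp γ) hγ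

namespace IsTameCyclicQuotient

variable {k : ℕ} {p : C(Y, N)} {t : Y ≃ₜ Y}

theorem apply_pow (hp : IsTameCyclicQuotient k p t) (i : ℕ) (y : Y) : p ((t ^ i) y) = p y :=
  ((hp.fibre _ _).2 ⟨i, rfl⟩).symm

theorem eventually_of_comp (hp : IsTameCyclicQuotient k p t) {P : N → Prop} {y : Y}
    (h : ∀ᶠ y' in 𝓝 y, P (p y')) : ∀ᶠ x in 𝓝 (p y), P x :=
  hp.isOpenMap.nhds_le y h

/-- Near each point, an invariant cocycle has a primitive that is constant on the fibres of `p`. -/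
theorem exists_primitive_nhd (hp : IsTameCyclicQuotient k p t) {c : SingularSimplex 1 Y → ℝ}
    (hc : coboundary 1 Y c = 0) (hinv : ∀ γ, c ((t : C(Y, Y)).comp γ) = c γ) (y : Y) :
    ∃ V : Set Y, IsOpen V ∧ y ∈ V ∧ ∃ f : Y → ℝ, IsPrimitiveOn c f V ∧
      ∀ v ∈ V, ∀ v' ∈ V, p v = p v' → f v = f v' := by
  obtain ⟨V, hV, hy, hcon, h⟩ := hp.exists_nhd y
  obtain ⟨f, hf⟩ := exists_isPrimitiveOn_of_contractible (V := V) hc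
  rcases h with h | h
  · refine ⟨V, hV, hy, _, hf.iterateAverage hp.pos hinv h, fun v _ v' _ hvv' => ?_⟩
    obtain ⟨i, rfl⟩ := (hp.fibre _ _).1 hvv'
    exact (iterateAverage_apply_pow hp.pow_eq_one f i v).symm
  · exact ⟨V, hV, hy, f, hf, fun v hv v' hv' hvv' => by rw [h hv hv' hvv']⟩

theorem exists_local_primitive (hp : IsTameCyclicQuotient k p t) {c : SingularSimplex 1 Y → ℝ}
    (hc : coboundary 1 Y c = 0) (hinv : ∀ γ, c ((t : C(Y, Y)).comp γ) = c γ) (x : N) :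
    ∃ U : Set N, IsOpen U ∧ x ∈ U ∧ ∃ F : N → ℝ, ∀ y, p y ∈ U →
      ∃ W ∈ 𝓝 y, IsPrimitiveOn c (F ∘ p) W := by
  obtain ⟨y, rfl⟩ := hp.surjective x
  obtain ⟨V, hV, hy, f, hf, hconst⟩ := hp.exists_primitive_nhd hc hinv y
  have hsec (u : N) : ∃ v, u ∈ p '' V → v ∈ V ∧ p v = u := by
    by_cases hu : u ∈ p '' V
    · exact hu.imp fun v hv _ => hv
    · exact ⟨y, fun h => absurd h hu⟩
  choose r hr using hsec
  have hF (v) (hv : v ∈ V) : f (r (p v)) = f v :=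
    hconst _ (hr _ ⟨v, hv, rfl⟩).1 _ hv (hr _ ⟨v, hv, rfl⟩).2
  refine ⟨p '' V, hp.isOpenMap _ hV, ⟨y, hy, rfl⟩, fun u => f (r u), ?_⟩
  rintro y' ⟨v, hv, hvy'⟩
  obtain ⟨i, rfl⟩ := (hp.fibre _ _).1 hvy'
  -- The primitive on `V` is transported to the translate of `V` by `t ^ i`.
  refine ⟨(t ^ i : Y ≃ₜ Y).symm ⁻¹' V, (hV.preimage (t ^ i).symm.continuous).mem_nhds (by simpa),
    fun γ hγ => ?_⟩
  let γ' : SingularSimplex 1 Y := ((t ^ i : Y ≃ₜ Y).symm : C(Y, Y)).comp γ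
  have hγ' : ((t ^ i : Y ≃ₜ Y) : C(Y, Y)).comp γ' = γ := by
    ext x
    exact (t ^ i).apply_symm_apply _
  have hpγ' (x) : p (γ x) = p (γ' x) := by
    rw [← hp.apply_pow i (γ' x)]
    exact congrArg p (DFunLike.congr_fun hγ' x).symm
  rw [← hγ', cochain_pow_comp hinv, hγ', hf γ' hγ]
  simp only [Function.comp_apply, hpγ']
  rw [hF (γ' _) (hγ _), hF (γ' _) (hγ _)]

/-- If `H¹(N; ℝ) = 0`, then every invariant cocycle on `Y` is exact. -/
theorem exists_isPrimitive [LocallyPathConnectedSpace Y] (hp : IsTameCyclicQuotient k p t)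
    (hN : ∀ c : SingularSimplex 1 N → ℝ, coboundary 1 N c = 0 → ∃ f, IsPrimitive c f)
    {c : SingularSimplex 1 Y → ℝ} (hc : coboundary 1 Y c = 0)
    (hinv : ∀ γ, c ((t : C(Y, Y)).comp γ) = c γ) : ∃ f, IsPrimitive c f := by
  choose U hU hxU F hF using hp.exists_local_primitive hc hinv
  let D : MultivaluedFunction N :=
    { dom := U
      isOpen_dom := hU
      mem_dom := hxU
      fn := F
      compat := by
        rintro i j x ⟨hi, hj⟩
        obtain ⟨y, rfl⟩ := hp.surjective x
        obtain ⟨W, hW, h⟩ := hF i y hi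
        obtain ⟨W', hW', h'⟩ := hF j y hj
        exact hp.eventually_of_comp <| (h.mono Set.inter_subset_left).eventually_sub_eq
          (h'.mono Set.inter_subset_right) (Filter.inter_mem hW hW') }
  obtain ⟨G, hG⟩ := D.exists_global_branch hN
  refine ⟨G ∘ p, fun γ => ?_⟩
  obtain ⟨h, hh⟩ := exists_isPrimitive_of_contractible (c := cochainPullback 1 γ c)
    (by rw [coboundary_cochainPullback, hc, map_zero])
  have hb : D.IsBranch (p.comp γ) h := by
    intro a i ha
    obtain ⟨W, hW, hWF⟩ := hF i (γ a) ha
    exact IsPrimitiveOn.eventually_sub_eq (fun δ _ => hh δ) (hWF.comp_preimage γ)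
      (γ.continuous.continuousAt hW)
  exact (hh (.id _)).trans (hG _ h hb)

/-- The pull-back `H¹(N; ℝ) → H¹(Y; ℝ)` is injective. -/
theorem exists_isPrimitive_of_pullback [LocallyPathConnectedSpace Y]
    (hp : IsTameCyclicQuotient k p t)
    (hN : ∀ x : N, ∃ U : Set N, IsOpen U ∧ x ∈ U ∧ ContractibleSpace U)
    {c : SingularSimplex 1 N → ℝ} (hc : coboundary 1 N c = 0) {f : Y → ℝ}
    (hf : IsPrimitive (cochainPullback 1 p c) f) : ∃ F, IsPrimitive c F := by
  have hinv (γ : SingularSimplex 1 Y) :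
      cochainPullback 1 p c ((t : C(Y, Y)).comp γ) = cochainPullback 1 p c γ := by
    refine congrArg c ?_
    ext x
    exact hp.apply_pow 1 (γ x)
  have hf' : IsPrimitiveOn (cochainPullback 1 p c) (iterateAverage k t f) Set.univ :=
    IsPrimitiveOn.iterateAverage hp.pos hinv (fun _ _ => trivial) fun γ _ => hf γ
  choose r hr using hp.surjective
  have hF (y : Y) : iterateAverage k t f (r (p y)) = iterateAverage k t f y := by
    obtain ⟨i, hi⟩ := (hp.fibre y (r (p y))).1 (hr _).symm
    rw [← hi, iterateAverage_apply_pow hp.pow_eq_one]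
  refine ⟨fun x => iterateAverage k t f (r x), fun γ => ?_⟩
  obtain ⟨h, hh⟩ := exists_isPrimitive_of_contractible (c := cochainPullback 1 γ c)
    (by rw [coboundary_cochainPullback, hc, map_zero])
  have hl : IsLocallyConstant fun a => h a - iterateAverage k t f (r (γ a)) := by
    rw [IsLocallyConstant.iff_eventually_eq]
    intro a
    obtain ⟨U, hU, haU, hcon⟩ := hN (γ a)
    obtain ⟨g, hg⟩ := exists_isPrimitiveOn_of_contractible (V := U) hc
    have h₁ := IsPrimitiveOn.eventually_sub_eq (fun δ _ => hh δ) (hg.comp_preimage γ)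
      ((hU.preimage γ.continuous).mem_nhds haU)
    obtain ⟨y, hy⟩ := hp.surjective (γ a)
    have h₂ := (hf'.mono (Set.subset_univ _)).eventually_sub_eq (hg.comp_preimage p)
      ((hU.preimage p.continuous).mem_nhds (hy.symm ▸ haU : p y ∈ U))
    have h₃ := hp.eventually_of_comp (y := y)
      (P := fun x => iterateAverage k t f (r x) - g x = iterateAverage k t f (r (p y)) - g (p y))
      (h₂.mono fun z hz => by simpa only [hF, Function.comp_apply] using hz)
    rw [hy] at h₃
    filter_upwards [h₁, γ.continuous.continuousAt.eventually h₃] with b hb hb'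
    simp only [Function.comp_apply] at hb
    linarith
  have h₁ := hl.apply_eq_of_preconnectedSpace (edgeVertex 1) (edgeVertex 0)
  have h₂ := hh (.id _)
  have h₃ : cochainPullback 1 γ c (.id _) = c γ := rfl
  simp only [ContinuousMap.id_apply] at h₂
  linarith

end IsTameCyclicQuotient

end

noncomputable section

/-! ### Orbit spaces of finite cyclic actions -/

open Topology

theorem isLocalHomeomorphOn_of_injOn {X Z : Type} [TopologicalSpace X] [TopologicalSpace Z]
    {f : X → Z} (hc : Continuous f) (ho : IsOpenMap f) {s : Set X}
    (h : ∀ x ∈ s, ∃ V : Set X, IsOpen V ∧ x ∈ V ∧ Set.InjOn f V) : IsLocalHomeomorphOn f s := by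
  intro x hx
  obtain ⟨V, hV, hxV, hinj⟩ := h x hx
  have : Nonempty X := ⟨x⟩
  exact ⟨.ofContinuousOpen (hinj.toPartialEquiv f V) hc.continuousOn ho hV, hxV, rfl⟩

namespace OrbitSpace

variable {Y : Type} [TopologicalSpace Y] {h t : Y ≃ₜ Y}

theorem proj_surjective (h : Y ≃ₜ Y) : Function.Surjective (proj h) := Quotient.mk_surjective

theorem isQuotientMap_proj (h : Y ≃ₜ Y) : IsQuotientMap (proj h) := isQuotientMap_quotient_mk'

theorem proj_eq_iff_zpow {y y' : Y} : proj h y = proj h y' ↔ ∃ i : ℤ, (h ^ i) y = y' :=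
  Quotient.eq (r := orbitSetoid h)

theorem proj_pow (i : ℕ) (y : Y) : proj h ((h ^ i) y) = proj h y :=
  (proj_eq_iff_zpow.2 ⟨i, by rw [zpow_natCast]⟩).symm

theorem proj_eq_iff {n : ℕ} (hn : 0 < n) (hh : h ^ n = 1) {y y' : Y} :
    proj h y = proj h y' ↔ ∃ i : ℕ, (h ^ i) y = y' := by
  refine ⟨fun he => ?_, fun ⟨i, hi⟩ => hi ▸ (proj_pow i y).symm⟩
  obtain ⟨i, rfl⟩ := proj_eq_iff_zpow.1 he
  have hn' : (0 : ℤ) < n := by exact_mod_cast hn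
  obtain ⟨j, hj⟩ := Int.eq_ofNat_of_zero_le (Int.emod_nonneg i hn'.ne')
  refine ⟨j, ?_⟩
  conv_rhs => rw [← Int.emod_add_mul_ediv i n, zpow_add, zpow_mul, zpow_natCast, hh, one_zpow,
    mul_one]
  rw [hj]
  exact congrArg (· y) (zpow_natCast h j).symm

theorem isOpenQuotientMap_proj (h : Y ≃ₜ Y) : IsOpenQuotientMap (proj h) := by
  refine ⟨proj_surjective h, (proj h).continuous, fun V hV => ?_⟩
  rw [← (isQuotientMap_proj h).isOpen_preimage]
  have : proj h ⁻¹' (proj h '' V) = ⋃ i : ℤ, (h ^ i) '' V := by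
    ext y
    simp only [Set.mem_preimage, Set.mem_image, Set.mem_iUnion, proj_eq_iff_zpow]
    exact ⟨fun ⟨v, hv, i, hi⟩ => ⟨i, v, hv, hi⟩, fun ⟨i, v, hv, hi⟩ => ⟨v, hv, i, hi⟩⟩
  rw [this]
  exact isOpen_iUnion fun i => (h ^ i).isOpenMap _ hV

theorem t2Space [T2Space Y] {n : ℕ} (hn : 0 < n) (hh : h ^ n = 1) : T2Space (OrbitSpace h) := by
  rw [t2Space_iff_of_isOpenQuotientMap (isOpenQuotientMap_proj h)]
  have : {x : Y × Y | proj h x.1 = proj h x.2} =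
      ⋃ i ∈ Finset.range n, {x : Y × Y | (h ^ i) x.1 = x.2} := by
    ext ⟨y, y'⟩
    simp only [Set.mem_ofPred_eq, Set.mem_iUnion, Finset.mem_range, proj_eq_iff hn hh, exists_prop]
    refine ⟨fun ⟨i, hi⟩ => ⟨i % n, Nat.mod_lt _ hn, ?_⟩, fun ⟨i, _, hi⟩ => ⟨i, hi⟩⟩
    rw [← hi, pow_eq_pow_mod i hh]
  rw [this]
  exact isClosed_biUnion_finset fun i _ =>
    isClosed_eq ((h ^ i).continuous.comp continuous_fst) continuous_snd

instance [CompactSpace Y] : CompactSpace (OrbitSpace h) :=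
  inferInstanceAs (CompactSpace (Quotient (orbitSetoid h)))

theorem induced_pow_proj (t : Y ≃ₜ Y) (m i : ℕ) (y : Y) :
    (induced t m ^ i) (proj (t ^ m) y) = proj (t ^ m) ((t ^ i) y) := by
  induction i with
  | zero => rfl
  | succ i ih => rw [pow_succ', Homeomorph.mul_apply, ih, pow_succ']; rfl

end OrbitSpace

/-! ### Spaces with charts in `ℂ × ℝ` -/

theorem exists_ball_subset_source {X : Type} [TopologicalSpace X]
    (ψ : OpenPartialHomeomorph X (ℂ × ℝ)) {x : X} (hx : x ∈ ψ.source) {W : Set X} (hW : W ∈ 𝓝 x) :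
    ∃ r, IsOpen (ψ.source ∩ ψ ⁻¹' Metric.ball (ψ x) r) ∧
      x ∈ ψ.source ∩ ψ ⁻¹' Metric.ball (ψ x) r ∧
      ψ.source ∩ ψ ⁻¹' Metric.ball (ψ x) r ⊆ W ∧
      ContractibleSpace ↥(ψ.source ∩ ψ ⁻¹' Metric.ball (ψ x) r) := by
  have h : ψ.target ∩ ψ.symm ⁻¹' W ∈ 𝓝 (ψ x) :=
    Filter.inter_mem (ψ.open_target.mem_nhds (ψ.map_source hx))
      ((ψ.tendsto_symm hx) hW)
  obtain ⟨r, hr, hball⟩ := Metric.mem_nhds_iff.1 h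
  refine ⟨r, ψ.isOpen_inter_preimage Metric.isOpen_ball, ⟨hx, Metric.mem_ball_self hr⟩, ?_, ?_⟩
  · rintro z ⟨hz, hzr⟩
    have := (hball hzr).2
    rwa [Set.mem_preimage, ψ.left_inv hz] at this
  · have hc : ContractibleSpace (Metric.ball (ψ x) r) :=
      (convex_ball _ _).contractibleSpace ⟨_, Metric.mem_ball_self hr⟩
    refine (ψ.homeomorphOfImageSubsetSource (s := ψ.source ∩ ψ ⁻¹' Metric.ball (ψ x) r)
      (t := Metric.ball (ψ x) r) Set.inter_subset_left ?_).contractibleSpace_iff.2 hc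
    ext z
    constructor
    · rintro ⟨y, ⟨-, hy⟩, rfl⟩
      exact hy
    · intro hz
      have hzt := (hball hz).1
      exact ⟨ψ.symm z, ⟨ψ.map_target hzt, by rwa [Set.mem_preimage, ψ.right_inv hzt]⟩,
        ψ.right_inv hzt⟩

theorem locallyPathConnectedSpace_of_charts {X : Type} [TopologicalSpace X]
    (hX : ∀ x : X, ∃ e : OpenPartialHomeomorph X (ℂ × ℝ), x ∈ e.source) :
    LocallyPathConnectedSpace X := by
  choose e he using hX
  let : ChartedSpace (ℂ × ℝ) X := ⟨Set.univ, e, he, fun _ => trivial⟩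
  exact ChartedSpace.locallyPathConnectedSpace (ℂ × ℝ) X

/-! ### Cyclic branched coverings -/

namespace IsCyclicBranchedCovering

variable {Y N : Type} [TopologicalSpace Y] [TopologicalSpace N] {k : ℕ} {B : Set N}
  {A : Set (OpenPartialHomeomorph N (ℂ × ℝ))} {q : Y → N} {t : Y ≃ₜ Y}

theorem apply_pow (hq : IsCyclicBranchedCovering k B A q t) (i : ℕ) (y : Y) :
    q ((t ^ i) y) = q y :=
  ((hq.fibre _ _).2 ⟨i, rfl⟩).symm

theorem isOpenMap [CompactSpace Y] [T2Space N] (hq : IsCyclicBranchedCovering k B A q t) :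
    IsOpenMap q := by
  intro V hV
  have hquot : IsQuotientMap q :=
    hq.continuous.isClosedMap.isQuotientMap hq.continuous hq.surjective
  rw [← hquot.isOpen_preimage]
  have : q ⁻¹' (q '' V) = ⋃ i : ℕ, (t ^ i) '' V := by
    ext y
    simp only [Set.mem_preimage, Set.mem_image, Set.mem_iUnion, hq.fibre]
    exact ⟨fun ⟨v, hv, i, hi⟩ => ⟨i, v, hv, hi⟩, fun ⟨i, v, hv, hi⟩ => ⟨v, hv, i, hi⟩⟩
  rw [this]
  exact isOpen_iUnion fun i => (t ^ i).isOpenMap _ hV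

theorem dvd_of_pow_apply_eq (hk : 0 < k) (hq : IsCyclicBranchedCovering k B A q t) {y : Y}
    (hy : q y ∉ B) {i : ℕ} (hi : (t ^ i) y = y) : k ∣ i := by
  rw [pow_eq_pow_mod i hq.pow_eq_one] at hi
  by_contra h
  exact hq.free y hy (i % k) (Nat.pos_of_ne_zero fun h0 => h (Nat.dvd_of_mod_eq_zero h0))
    (Nat.mod_lt _ hk) hi

theorem exists_injOn (hq : IsCyclicBranchedCovering k B A q t) {y : Y} (hy : q y ∉ B) :
    ∃ V : Set Y, IsOpen V ∧ y ∈ V ∧ Set.InjOn q V := by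
  obtain ⟨e, he, rfl⟩ := hq.covering.isLocalHomeomorphOn y hy
  exact ⟨e.source, e.open_source, he, e.injOn⟩

/-- The charts of the base lift to charts of a branched covering. -/
theorem exists_chart (hq : IsCyclicBranchedCovering k B A q t)
    (hN : ∀ x : N, ∃ e : OpenPartialHomeomorph N (ℂ × ℝ), x ∈ e.source) (y : Y) :
    ∃ e : OpenPartialHomeomorph Y (ℂ × ℝ), y ∈ e.source := by
  by_cases hy : q y ∈ B
  · obtain ⟨-, -, ψ, hψ, -⟩ := hq.model y hy
    exact ⟨ψ, hψ⟩
  · obtain ⟨e, he, rfl⟩ := hq.covering.isLocalHomeomorphOn y hy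
    obtain ⟨e', he'⟩ := hN (e y)
    exact ⟨e.trans e', by simp [he, he']⟩

theorem chart_pow {ψ : OpenPartialHomeomorph Y (ℂ × ℝ)} {ζ : ℂ}
    (hψ : ∀ y ∈ ψ.source, t y ∈ ψ.source ∧ ψ (t y) = (ζ * (ψ y).1, (ψ y).2)) (i : ℕ) {y : Y}
    (hy : y ∈ ψ.source) :
    (t ^ i) y ∈ ψ.source ∧ ψ ((t ^ i) y) = (ζ ^ i * (ψ y).1, (ψ y).2) := by
  induction i with
  | zero => simpa using hy
  | succ i ih =>
    rw [pow_succ', Homeomorph.mul_apply]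
    refine ⟨(hψ _ ih.1).1, ?_⟩
    rw [(hψ _ ih.1).2, ih.2, pow_succ', mul_assoc]

/-- In a chart where `t` is the rotation by `2π/(mn)`, the quotient by `t ^ m` is
`(w, s) ↦ (w ^ n, s)`: this map provides a chart of the orbit space. -/
theorem exists_quotientChart [Nonempty Y] {m n : ℕ} (hm : 0 < m) (hn : 0 < n) (ht : t ^ (m * n) = 1)
    {ψ : OpenPartialHomeomorph Y (ℂ × ℝ)}
    (hψ : ∀ y ∈ ψ.source, t y ∈ ψ.source ∧
      ψ (t y) = (Complex.exp (2 * Real.pi * Complex.I / (m * n : ℕ)) * (ψ y).1, (ψ y).2)) :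
    ∃ φ : OpenPartialHomeomorph (OrbitSpace (t ^ m)) (ℂ × ℝ),
      φ.source = OrbitSpace.proj (t ^ m) '' ψ.source ∧
      ∀ y ∈ ψ.source, φ (OrbitSpace.proj (t ^ m) y) = ((ψ y).1 ^ n, (ψ y).2) := by
  have : NeZero n := ⟨hn.ne'⟩
  have htm : (t ^ m) ^ n = 1 := by rw [← pow_mul, ht]
  set ζ := Complex.exp (2 * Real.pi * Complex.I / (m * n : ℕ)) with hζ
  have hprim : IsPrimitiveRoot ζ (m * n) := Complex.isPrimitiveRoot_exp _ (by positivity)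
  have hprim' : IsPrimitiveRoot (ζ ^ m) n := hprim.pow (by positivity) rfl
  set π := OrbitSpace.proj (t ^ m) with hπ
  have hπq : IsOpenQuotientMap π := OrbitSpace.isOpenQuotientMap_proj _
  let Φ (y : Y) : ℂ × ℝ := ((ψ y).1 ^ n, (ψ y).2)
  have hΦpow (i : ℕ) {y : Y} (hy : y ∈ ψ.source) :
      ((t ^ m) ^ i) y ∈ ψ.source ∧ Φ (((t ^ m) ^ i) y) = Φ y := by
    rw [← pow_mul]
    obtain ⟨h₁, h₂⟩ := chart_pow hψ (m * i) hy
    refine ⟨h₁, ?_⟩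
    simp only [Φ, h₂, mul_pow]
    rw [← pow_mul, show m * i * n = m * n * i by ring, pow_mul, hprim.pow_eq_one, one_pow, one_mul]
  let r := Function.surjInv hπq.surjective
  let f (x : OrbitSpace (t ^ m)) : ℂ × ℝ := Φ (r x)
  have hf {y : Y} (hy : y ∈ ψ.source) : f (π y) = Φ y := by
    obtain ⟨i, hi⟩ := (OrbitSpace.proj_eq_iff hn htm).1
      (Function.surjInv_eq hπq.surjective (π y)).symm
    change Φ (r (π y)) = _
    rw [show r (π y) = ((t ^ m) ^ i) y from hi.symm, (hΦpow i hy).2]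
  have hinj : Set.InjOn f (π '' ψ.source) := by
    rintro _ ⟨y, hy, rfl⟩ _ ⟨y', hy', rfl⟩ h
    rw [hf hy, hf hy', Prod.mk.injEq] at h
    -- Two numbers with the same `n`-th power differ by a power of the primitive root `ζ ^ m`.
    obtain ⟨i, hi⟩ : ∃ i : ℕ, (ζ ^ m) ^ i * (ψ y).1 = (ψ y').1 := by
      by_cases h0 : (ψ y).1 = 0
      · rw [h0, zero_pow hn.ne', eq_comm, pow_eq_zero_iff hn.ne'] at h
        exact ⟨0, by rw [h0, h.1, mul_zero]⟩
      · obtain ⟨i, -, hi⟩ := hprim'.eq_pow_of_pow_eq_one (ξ := (ψ y').1 / (ψ y).1)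
          (by rw [div_pow, ← h.1, div_self (pow_ne_zero n h0)])
        exact ⟨i, by rw [hi, div_mul_cancel₀ _ h0]⟩
    obtain ⟨h₁, h₂⟩ := chart_pow hψ (m * i) hy
    have : (t ^ (m * i)) y = y' := by
      refine ψ.injOn h₁ hy' ?_
      rw [h₂, pow_mul, hi, h.2]
    rw [← this, pow_mul, OrbitSpace.proj_pow]
  have hcont : ContinuousOn f (π '' ψ.source) := by
    rintro _ ⟨y, hy, rfl⟩
    refine (hπq.continuousAt_comp_iff.1 ?_).continuousWithinAt
    have hΦ : ContinuousAt Φ y :=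
      ((continuous_fst.pow n).prodMk continuous_snd).continuousAt.comp (ψ.continuousAt hy)
    refine hΦ.congr ?_
    filter_upwards [ψ.open_source.mem_nhds hy] with z hz using (hf hz).symm
  have hopen : IsOpenMap ((π '' ψ.source).domRestrict f) := by
    intro W hW
    obtain ⟨W', hW', rfl⟩ := isOpen_induced_iff.1 hW
    have e : (π '' ψ.source).domRestrict f '' (Subtype.val ⁻¹' W') =
        Prod.map (fun w : ℂ => w ^ n) id '' (ψ '' (ψ.source ∩ π ⁻¹' W')) := by
      ext z
      constructor
      · rintro ⟨⟨_, y, hy, rfl⟩, hW, rfl⟩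
        exact ⟨ψ y, ⟨y, ⟨hy, hW⟩, rfl⟩, (hf hy).symm⟩
      · rintro ⟨_, ⟨y, ⟨hy, hW⟩, rfl⟩, rfl⟩
        exact ⟨⟨π y, y, hy, rfl⟩, hW, hf hy⟩
    rw [e]
    exact (Complex.isOpenQuotientMap_pow n).isOpenMap.prodMap IsOpenMap.id _
      (ψ.isOpen_image_of_subset_source (ψ.open_source.inter (hW'.preimage π.continuous))
        Set.inter_subset_left)
  have : Nonempty (OrbitSpace (t ^ m)) := ‹Nonempty Y›.map π
  exact ⟨.ofContinuousOpenRestrict (hinj.toPartialEquiv f _) hcont hopen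
    (hπq.isOpenMap _ ψ.open_source), rfl, fun y hy => hf hy⟩

/-- The orbit space of `t ^ m` is an intermediate branched covering with `m` sheets. -/
theorem quotient [CompactSpace Y] [T2Space N] {m n : ℕ} (hm : 0 < m) (hn : 0 < n)
    (hq : IsCyclicBranchedCovering (m * n) B A q t) {qm : OrbitSpace (t ^ m) → N}
    (hqm : ∀ y, qm (OrbitSpace.proj (t ^ m) y) = q y) :
    IsCyclicBranchedCovering m B A qm (OrbitSpace.induced t m) := by
  have htm : (t ^ m) ^ n = 1 := by rw [← pow_mul, hq.pow_eq_one]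
  have hπq := OrbitSpace.isOpenQuotientMap_proj (t ^ m)
  have := hq.t2
  have hT2 : T2Space (OrbitSpace (t ^ m)) := OrbitSpace.t2Space hn htm
  have hcomp : qm ∘ OrbitSpace.proj (t ^ m) = q := funext hqm
  have hcont : Continuous qm := hπq.continuous_comp_iff.1 (hcomp ▸ hq.continuous)
  have hopen : IsOpenMap qm := hπq.isOpenMap_iff.2 (hcomp ▸ hq.isOpenMap)
  refine ⟨hT2, hcont, fun x => ?_, ?_, fun x x' => ?_, fun x hx i hi₀ hi he => ?_, ?_,
    fun x hx => ?_⟩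
  · obtain ⟨y, rfl⟩ := hq.surjective x
    exact ⟨_, hqm y⟩
  · ext x
    obtain ⟨y, rfl⟩ := hπq.surjective x
    rw [OrbitSpace.induced_pow_proj]
    exact OrbitSpace.proj_pow 1 y
  · obtain ⟨y, rfl⟩ := hπq.surjective x
    obtain ⟨y', rfl⟩ := hπq.surjective x'
    simp only [hqm, OrbitSpace.induced_pow_proj, hq.fibre]
    constructor
    · rintro ⟨i, rfl⟩
      exact ⟨i, rfl⟩
    · rintro ⟨i, hi⟩
      obtain ⟨j, rfl⟩ := (OrbitSpace.proj_eq_iff hn htm).1 hi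
      exact ⟨m * j + i, by rw [pow_add, pow_mul]; rfl⟩
  · obtain ⟨y, rfl⟩ := hπq.surjective x
    rw [hqm] at hx
    rw [OrbitSpace.induced_pow_proj] at he
    obtain ⟨j, hj⟩ := (OrbitSpace.proj_eq_iff hn htm).1 he
    have := hq.dvd_of_pow_apply_eq (by positivity) hx (i := m * j + i)
      (by rw [pow_add, pow_mul]; exact hj)
    have h' : m ∣ i := (Nat.dvd_add_right (dvd_mul_right m j)).1 ((dvd_mul_right m n).trans this)
    exact absurd (Nat.le_of_dvd hi₀ h') (by omega)
  · refine .of_isLocalHomeomorphOn hcont (isLocalHomeomorphOn_of_injOn hcont hopen fun x hx => ?_)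
    obtain ⟨y, rfl⟩ := hπq.surjective x
    obtain ⟨V, hV, hyV, hinj⟩ := hq.exists_injOn (y := y) (by simpa [hqm] using hx)
    refine ⟨_, hπq.isOpenMap V hV, ⟨y, hyV, rfl⟩, ?_⟩
    rintro _ ⟨v, hv, rfl⟩ _ ⟨v', hv', rfl⟩ h
    rw [hqm, hqm] at h
    rw [hinj hv hv' h]
  · obtain ⟨y, rfl⟩ := hπq.surjective x
    rw [hqm] at hx
    obtain ⟨e, he, ψ, hy, hψ⟩ := hq.model y hx
    have : Nonempty Y := ⟨y⟩
    obtain ⟨φ, hφ, hφψ⟩ := exists_quotientChart hm hn hq.pow_eq_one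
      fun y' hy' => ⟨(hψ y' hy').2.1, (hψ y' hy').2.2.2⟩
    refine ⟨e, he, φ, hφ ▸ ⟨y, hy, rfl⟩, ?_⟩
    rw [hφ]
    rintro _ ⟨y', hy', rfl⟩
    obtain ⟨h₁, h₂, h₃, h₄⟩ := hψ y' hy'
    have h₅ : OrbitSpace.induced t m (OrbitSpace.proj (t ^ m) y') =
        OrbitSpace.proj (t ^ m) (t y') := rfl
    rw [hqm, h₅, hφψ _ hy', hφψ _ h₂, h₃, h₄]
    refine ⟨h₁, ⟨_, h₂, rfl⟩, by rw [mul_comm m n, pow_mul], ?_⟩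
    rw [mul_pow, ← Complex.exp_nat_mul]
    congr 3
    have : (n : ℂ) ≠ 0 := by exact_mod_cast hn.ne'
    have : (m : ℂ) ≠ 0 := by exact_mod_cast hm.ne'
    push_cast
    field_simp

/-- A branched covering is a branched covering, with `n` sheets, of the orbit space of `t ^ m`. -/
theorem proj [CompactSpace Y] {m n : ℕ} (hm : 0 < m) (hn : 0 < n)
    (hq : IsCyclicBranchedCovering (m * n) B A q t)
    (hA : ∀ e ∈ A, ∀ x ∈ e.source, x ∈ B ↔ (e x).1 = 0) {qm : OrbitSpace (t ^ m) → N}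
    (hqm : ∀ y, qm (OrbitSpace.proj (t ^ m) y) = q y) :
    IsCyclicBranchedCovering n (qm ⁻¹' B) {e | ∀ x ∈ e.source, x ∈ qm ⁻¹' B ↔ (e x).1 = 0}
      (OrbitSpace.proj (t ^ m)) (t ^ m) := by
  have htm : (t ^ m) ^ n = 1 := by rw [← pow_mul, hq.pow_eq_one]
  have hπq := OrbitSpace.isOpenQuotientMap_proj (t ^ m)
  have := hq.t2
  have hT2 : T2Space (OrbitSpace (t ^ m)) := OrbitSpace.t2Space hn htm
  refine ⟨hq.t2, hπq.continuous, hπq.surjective, htm, fun y y' => OrbitSpace.proj_eq_iff hn htm,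
    fun y hy i hi₀ hi he => ?_, ?_, fun y hy => ?_⟩
  · rw [Set.mem_preimage, hqm] at hy
    rw [← pow_mul] at he
    have := hq.dvd_of_pow_apply_eq (by positivity) hy he
    exact absurd (Nat.le_of_dvd hi₀ (Nat.dvd_of_mul_dvd_mul_left hm this)) (by omega)
  · refine .of_isLocalHomeomorphOn hπq.continuous
      (isLocalHomeomorphOn_of_injOn hπq.continuous hπq.isOpenMap fun y hy => ?_)
    obtain ⟨V, hV, hyV, hinj⟩ := hq.exists_injOn (y := y) (by simpa [hqm] using hy)
    exact ⟨V, hV, hyV, fun v hv v' hv' h => hinj hv hv' (by rw [← hqm, ← hqm, h])⟩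
  · rw [Set.mem_preimage, hqm] at hy
    obtain ⟨e, he, ψ, hy, hψ⟩ := hq.model y hy
    have hψt : ∀ y' ∈ ψ.source, t y' ∈ ψ.source ∧ ψ (t y') =
        (Complex.exp (2 * Real.pi * Complex.I / (m * n : ℕ)) * (ψ y').1, (ψ y').2) :=
      fun y' hy' => ⟨(hψ y' hy').2.1, (hψ y' hy').2.2.2⟩
    have : Nonempty Y := ⟨y⟩
    obtain ⟨φ, hφ, hφψ⟩ := exists_quotientChart hm hn hq.pow_eq_one hψt
    refine ⟨φ, ?_, ψ, hy, fun y' hy' => ?_⟩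
    · rw [Set.mem_ofPred_eq, hφ]
      rintro _ ⟨y', hy', rfl⟩
      obtain ⟨h₁, -, h₃, -⟩ := hψ y' hy'
      rw [Set.mem_preimage, hqm, hφψ _ hy', hA e he _ h₁, h₃, pow_eq_zero_iff hn.ne',
        pow_eq_zero_iff (by positivity)]
    · obtain ⟨h₁, h₂⟩ := chart_pow hψt m hy'
      refine ⟨hφ ▸ ⟨y', hy', rfl⟩, h₁, hφψ _ hy', ?_⟩
      rw [h₂, ← Complex.exp_nat_mul]
      congr 3
      have : (n : ℂ) ≠ 0 := by exact_mod_cast hn.ne'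
      have : (m : ℂ) ≠ 0 := by exact_mod_cast hm.ne'
      push_cast
      field_simp

/-- The deck transformation fixes the points over the branch locus, which have `w = 0` in the
model. -/
theorem apply_eq_self (hk : 0 < k) (hq : IsCyclicBranchedCovering k B A q t)
    (hA : ∀ e ∈ A, ∀ x ∈ e.source, x ∈ B ↔ (e x).1 = 0) {y : Y} (hy : q y ∈ B) : t y = y := by
  obtain ⟨e, he, ψ, hyψ, hψ⟩ := hq.model y hy
  obtain ⟨h₁, h₂, h₃, h₄⟩ := hψ y hyψ
  have h0 : (ψ y).1 = 0 := by
    rw [hA e he _ h₁, h₃] at hy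
    exact (pow_eq_zero_iff hk.ne').1 hy
  refine ψ.injOn h₂ hyψ ?_
  rw [h₄]
  exact Prod.ext (by rw [h0, mul_zero]) rfl

theorem pow_apply_eq_self_iff (hk : 0 < k) (hq : IsCyclicBranchedCovering k B A q t)
    (hA : ∀ e ∈ A, ∀ x ∈ e.source, x ∈ B ↔ (e x).1 = 0) {i : ℕ} (hi : ¬ k ∣ i) {y : Y} :
    (t ^ i) y = y ↔ q y ∈ B := by
  refine ⟨fun h => ?_, fun h => ?_⟩
  · by_contra hy
    exact hi (hq.dvd_of_pow_apply_eq hk hy h)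
  · clear hi
    induction i with
    | zero => rfl
    | succ i ih => rw [pow_succ, Homeomorph.mul_apply, hq.apply_eq_self hk hA h, ih]

theorem isTameCyclicQuotient (hk : 0 < k) (hq : IsCyclicBranchedCovering k B A q t)
    (hA : ∀ e ∈ A, ∀ x ∈ e.source, x ∈ B ↔ (e x).1 = 0) (hopen : IsOpenMap q)
    (hN : ∀ x : N, ∃ e : OpenPartialHomeomorph N (ℂ × ℝ), x ∈ e.source) :
    IsTameCyclicQuotient k ⟨q, hq.continuous⟩ t := by
  refine ⟨hk, hq.surjective, hopen, hq.pow_eq_one, hq.fibre, fun y => ?_⟩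
  by_cases hy : q y ∈ B
  · obtain ⟨e, he, ψ, hyψ, hψ⟩ := hq.model y hy
    obtain ⟨r, h₁, h₂, -, h₄⟩ := exists_ball_subset_source ψ hyψ Filter.univ_mem
    refine ⟨_, h₁, h₂, h₄, Or.inl ?_⟩
    rintro v ⟨hv, hvr⟩
    obtain ⟨-, hv', -, hvt⟩ := hψ v hv
    have h0 : (ψ y).1 = 0 := by
      rw [hA e he _ (hψ y hyψ).1, (hψ y hyψ).2.2.1] at hy
      exact (pow_eq_zero_iff hk.ne').1 hy
    have hnorm : ‖Complex.exp (2 * Real.pi * Complex.I / k)‖ = 1 := by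
      have : (2 * Real.pi * Complex.I / k : ℂ) = ((2 * Real.pi / k : ℝ) : ℂ) * Complex.I := by
        push_cast; ring
      rw [this, Complex.norm_exp_ofReal_mul_I]
    refine ⟨hv', ?_⟩
    rw [Set.mem_preimage, Metric.mem_ball, Prod.dist_eq, h0, dist_zero_right] at hvr ⊢
    rwa [hvt, norm_mul, hnorm, one_mul]
  · obtain ⟨e, he⟩ := hq.exists_chart hN y
    obtain ⟨V, hV, hyV, hinj⟩ := hq.exists_injOn hy
    obtain ⟨r, h₁, h₂, h₃, h₄⟩ := exists_ball_subset_source e he (hV.mem_nhds hyV)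
    exact ⟨_, h₁, h₂, h₄, Or.inr (hinj.mono h₃)⟩

end IsCyclicBranchedCovering

end

noncomputable section

/-! ### Consequences for the first cohomology group -/

theorem H1.pullback_pullback {X Y Z : Type} [TopologicalSpace X] [TopologicalSpace Y]
    [TopologicalSpace Z] (f : C(X, Y)) (g : C(Y, Z)) (α : H1 Z) :
    H1.pullback f (H1.pullback g α) = H1.pullback (g.comp f) α := by
  induction α using Submodule.Quotient.induction_on with | _ c => rfl

namespace IsTameCyclicQuotient

variable {Y N : Type} [TopologicalSpace Y] [TopologicalSpace N] {k : ℕ} {p : C(Y, N)} {t : Y ≃ₜ Y}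

/-- The involution of a double quotient of a space with vanishing `H¹` acts by `-1` on `H¹`. -/
theorem pullback_eq_neg [LocallyPathConnectedSpace Y] (hp : IsTameCyclicQuotient 2 p t)
    (hN : ∀ c : SingularSimplex 1 N → ℝ, coboundary 1 N c = 0 → ∃ f, IsPrimitive c f)
    (α : H1 Y) : H1.pullback (t : C(Y, Y)) α = -α := by
  rw [eq_neg_iff_add_eq_zero]
  induction α using Submodule.Quotient.induction_on with | _ c =>
  refine (H1.mk_eq_zero_iff (c := cocyclePullback (t : C(Y, Y)) c + c)).2 ?_
  refine hp.exists_isPrimitive hN (cocyclePullback (t : C(Y, Y)) c + c).2 fun γ => ?_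
  change c.1 ((t : C(Y, Y)).comp ((t : C(Y, Y)).comp γ)) + c.1 ((t : C(Y, Y)).comp γ) =
    c.1 ((t : C(Y, Y)).comp γ) + c.1 γ
  have : (t : C(Y, Y)).comp ((t : C(Y, Y)).comp γ) = γ := by
    ext x
    have := DFunLike.congr_fun hp.pow_eq_one (γ x)
    rwa [pow_two] at this
  rw [this, add_comm]

theorem pullback_injective [LocallyPathConnectedSpace Y] (hp : IsTameCyclicQuotient k p t)
    (hN : ∀ x : N, ∃ U : Set N, IsOpen U ∧ x ∈ U ∧ ContractibleSpace U) :
    Function.Injective (H1.pullback p) := by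
  rw [injective_iff_map_eq_zero]
  intro α hα
  induction α using Submodule.Quotient.induction_on with | _ c =>
  obtain ⟨f, hf⟩ := (H1.mk_eq_zero_iff (c := cocyclePullback p c)).1 hα
  exact H1.mk_eq_zero_iff.2 (hp.exists_isPrimitive_of_pullback hN c.2 hf)

end IsTameCyclicQuotient

end

theorem proposition3p1
    {M : Type} [TopologicalSpace M] [T2Space M] [CompactSpace M]
    [ChartedSpace (ℂ × ℝ) M] [IsManifold 𝓘(ℝ, ℂ × ℝ) ∞ M]
    (o : SmoothOrientation M) (hM : HasRationalHomologyOfThreeSphere M) (L : OrientedLink o)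
    {M₆ : Type} [TopologicalSpace M₆] [CompactSpace M₆] (q : M₆ → M) (t : M₆ ≃ₜ M₆)
    (hq : L.IsCyclicBranchedCover 6 q t)
    (hb : firstBetti (OrbitSpace (t ^ 2)) ≠ 0) :
    -- `M₂ = M₆ / ⟨t ^ 2⟩` and `M₃ = M₆ / ⟨t ^ 3⟩` are the 2- and 3-fold cyclic branched covers
    L.IsCyclicBranchedCover 2 (hq.quotientMap 2) (OrbitSpace.induced t 2) ∧
    L.IsCyclicBranchedCover 3 (hq.quotientMap 3) (OrbitSpace.induced t 3) ∧
    -- every class pulled back from `M₂` gives a symmetric triple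
    (∀ α : H1 (OrbitSpace (t ^ 2)),
      ∀ χ : H1 M₆, χ = H1.pullback (OrbitSpace.proj (t ^ 2)) α →
        IsZ3SymmetricTriple (OrbitSpace.proj (t ^ 3)) (t ^ 3) χ ∧
        H1.pullback ((t ^ 3 : M₆ ≃ₜ M₆) : C(M₆, M₆)) χ = -χ ∧
        H1.pullback ((t ^ 2 : M₆ ≃ₜ M₆) : C(M₆, M₆)) χ = χ) ∧
    -- and nonzero such classes exist
    ∃ α : H1 (OrbitSpace (t ^ 2)), H1.pullback (OrbitSpace.proj (t ^ 2)) α ≠ 0 := by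
  have hslice := L.slice
  have hMc (x : M) : ∃ e : OpenPartialHomeomorph M (ℂ × ℝ), x ∈ e.source :=
    ⟨chartAt _ x, mem_chart_source _ x⟩
  have hMH : ∀ c : SingularSimplex 1 M → ℝ, coboundary 1 M c = 0 → ∃ f, IsPrimitive c f :=
    fun c hc => exists_isPrimitive_of_isZero_homology (by simpa using hM 1) hc
  have h₂ : IsCyclicBranchedCovering 2 L.carrier L.charts (hq.quotientMap 2)
      (OrbitSpace.induced t 2) :=
    IsCyclicBranchedCovering.quotient (m := 2) (n := 3) two_pos three_pos hq fun _ => rfl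
  have h₃ : IsCyclicBranchedCovering 3 L.carrier L.charts (hq.quotientMap 3)
      (OrbitSpace.induced t 3) :=
    IsCyclicBranchedCovering.quotient (m := 3) (n := 2) three_pos two_pos hq fun _ => rfl
  have hp₂ := IsCyclicBranchedCovering.proj (m := 2) (n := 3) two_pos three_pos hq hslice
    (qm := hq.quotientMap 2) fun _ => rfl
  have hp₃ := IsCyclicBranchedCovering.proj (m := 3) (n := 2) three_pos two_pos hq hslice
    (qm := hq.quotientMap 3) fun _ => rfl
  have hM₂c := h₂.exists_chart hMc
  have hM₃c := h₃.exists_chart hMc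
  have hM₆c := IsCyclicBranchedCovering.exists_chart hq hMc
  have := locallyPathConnectedSpace_of_charts hM₂c
  have := locallyPathConnectedSpace_of_charts hM₆c
  have hneg := (h₂.isTameCyclicQuotient two_pos hslice h₂.isOpenMap hMc).pullback_eq_neg hMH
  have hinj := (hp₂.isTameCyclicQuotient three_pos (fun _ he => he)
    (OrbitSpace.isOpenQuotientMap_proj _).isOpenMap hM₂c).pullback_injective fun x => by
      obtain ⟨e, he⟩ := hM₂c x
      obtain ⟨r, h, h', -, h''⟩ := exists_ball_subset_source e he Filter.univ_mem
      exact ⟨_, h, h', h''⟩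
  refine ⟨h₂, h₃, ?_, ?_⟩
  · rintro α _ rfl
    have hσ : H1.pullback ((t ^ 3 : M₆ ≃ₜ M₆) : C(M₆, M₆))
        (H1.pullback (OrbitSpace.proj (t ^ 2)) α) = -H1.pullback (OrbitSpace.proj (t ^ 2)) α := by
      rw [← map_neg, ← hneg, H1.pullback_pullback, H1.pullback_pullback]
      congr 2
      ext y
      -- `t ^ 3` and `t` induce the same homeomorphism of `M₂`
      exact OrbitSpace.proj_pow (h := t ^ 2) 1 (t y)
    have hτ : H1.pullback ((t ^ 2 : M₆ ≃ₜ M₆) : C(M₆, M₆))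
        (H1.pullback (OrbitSpace.proj (t ^ 2)) α) = H1.pullback (OrbitSpace.proj (t ^ 2)) α := by
      rw [H1.pullback_pullback]
      congr 2
      ext y
      exact OrbitSpace.proj_pow (h := t ^ 2) 1 y
    have hfix : {x | (OrbitSpace.induced t 3 ^ 2) x = x} = hq.quotientMap 3 ⁻¹' L.carrier := by
      ext x
      obtain ⟨y, rfl⟩ := OrbitSpace.proj_surjective _ x
      have hiff (j : ℕ) : (t ^ (3 * j + 2)) y = y ↔ q y ∈ L.carrier :=
        IsCyclicBranchedCovering.pow_apply_eq_self_iff (by norm_num) hq hslice (by omega)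
      rw [Set.mem_ofPred_eq, OrbitSpace.induced_pow_proj,
        OrbitSpace.proj_eq_iff two_pos hp₃.pow_eq_one]
      simp only [← Homeomorph.mul_apply, ← pow_mul, ← pow_add, hiff, exists_const]
      rfl
    refine ⟨⟨⟨hq.t2, inferInstance, hM₆c⟩, ⟨h₃.t2, inferInstance, hM₃c⟩,
      OrbitSpace.induced t 3 ^ 2, ?_, ?_, t ^ 2, fun y => ?_, fun y => ?_, hσ, hτ⟩, hσ, hτ⟩
    · rw [← pow_mul, mul_comm, pow_mul, h₃.pow_eq_one, one_pow]
    · rw [hfix, IsDoubleBranchedCover]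
      exact hp₃
    · exact (OrbitSpace.induced_pow_proj t 3 2 y).symm
    · rw [← Homeomorph.mul_apply, ← Homeomorph.mul_apply, ← pow_add, ← pow_add]
  · by_contra! h
    have : Subsingleton (H1 (OrbitSpace (t ^ 2))) :=
      subsingleton_of_forall_eq 0 fun α => hinj ((h α).trans (map_zero _).symm)
    exact hb (rank_subsingleton' ℝ _)
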